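/- Let $\tau_L,\tau_R\in\mathbb R$ and $\delta_L,\delta_R>0$, and let $f:\mathbb R^2\to\mathbb R^2$ be the two-dimensional border-collision normal form $$f(x)=\begin{cases}(\tau_L x_1+x_2+1,\,-\delta_L x_1), & x_1\le 0,\\ (\tau_R x_1+x_2+1,\,-\delta_R x_1), & x_1\ge 0,\end{cases}$$ which is a homeomorphism. Let $\Sigma=\{x\in\mathbb R^2: x_1=0\}$, let $\beta>0$ and $X=(0,\beta)$. Suppose that there exist $i,j\ge 1$ such that $f^i(X)_1\le 0$ and $f^{-j}(X)_1\ge 0$, and let $r$ and $\ell$ be the smallest such $i$ and $j$, respectively (then $r,\ell\ge 2$). Let $Z=f^r(X)$ and $V=f^{-(\ell-1)}(X)$, let $Y$ be the intersection of $\Sigma$ with the line through $Z$ and $f^{-1}(Z)$, and let $U$ be the intersection of $f(\Sigma)=\{x: x_2=0\}$ with the line through $V$ and $f(V)$. Let $\Omega$ be the union of the closed polygonal chain formed by connecting the points $$U,\ f^{-(\ell-2)}(X),\ \ldots,\ f^{-1}(X),\ X,\ f(X),\ \ldots,\ f^{r-1}(X),\ Z$$ in order, and then $Z$ back to $U$,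 and of the region enclosed by this chain. Suppose that * $Y$ lies above $f^{-1}(U)$ (both points are on $\Sigma$), * $Z$ lies above the line through $f^{-1}(U)$ and $V$, and * $Z$ lies to the right of the line through $V$ and $f(V)$. Then $\Omega$ is forward invariant under $f$, that is, $f(\Omega)\subseteq\Omega$. Moreover, for every $\varepsilon>0$ there exists a nonempty compact set $\Omega_{\rm trap}\subseteq\Omega$ with $f(\Omega_{\rm trap})\subseteq{\rm int}(\Omega_{\rm trap})$ (a trapping region for $f$) such that $d_H(\Omega,\Omega_{\rm trap})\le\varepsilon$, where $d_H$ denotes the Hausdorff distance. -/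

import Mathlib

/-- The plane with the Euclidean norm; `x 0` and `x 1` are the first and second coordinates. -/
abbrev Plane : Type := EuclideanSpace ℝ (Fin 2)

/-- The affine half-map `x ↦ A x + b` with `A = [[τ, 1], [-δ, 0]]` and `b = (1, 0)`. -/
noncomputable def halfMap (τ δ : ℝ) (x : Plane) : Plane :=
  !₂[τ * x 0 + x 1 + 1, -δ * x 0]

/-- The two-dimensional border-collision normal form: the left half-map on `x₁ ≤ 0` and the
right half-map on `x₁ ≥ 0` (the two agree on `x₁ = 0`). -/
noncomputable def bcnf (τL δL τR δR : ℝ) (x : Plane) : Plane :=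
  if x 0 ≤ 0 then halfMap τL δL x else halfMap τR δR x

/-- The inverse of the half-map `halfMap τ δ`, for `δ ≠ 0`. -/
noncomputable def halfMapInv (τ δ : ℝ) (y : Plane) : Plane :=
  !₂[-y 1 / δ, y 0 - 1 + τ * (y 1 / δ)]

/-- The inverse of the border-collision normal form in the orientation-preserving case
`δL, δR > 0` (then `f` maps the left half-plane onto the upper half-plane and the right
half-plane onto the lower half-plane). See `bcnfInv_bcnf` and `bcnf_bcnfInv`. -/
noncomputable def bcnfInv (τL δL τR δR : ℝ) (y : Plane) : Plane :=
  if 0 ≤ y 1 then halfMapInv τL δL y else halfMapInv τR δR y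

theorem bcnfInv_bcnf (τL τR : ℝ) {δL δR : ℝ} (hL : 0 < δL) (hR : 0 < δR) :
    Function.LeftInverse (bcnfInv τL δL τR δR) (bcnf τL δL τR δR) := by
  intro x
  by_cases hx : x 0 ≤ 0
  · have h : 0 ≤ -δL * x 0 := by nlinarith
    have hf : bcnf τL δL τR δR x = halfMap τL δL x := if_pos hx
    rw [hf, bcnfInv, if_pos (by simpa [halfMap] using h)]
    ext i
    fin_cases i <;> simp [halfMap, halfMapInv] <;> field_simp <;> ring
  · have h : ¬ 0 ≤ -δR * x 0 := by push Not at hx ⊢; nlinarith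
    have hf : bcnf τL δL τR δR x = halfMap τR δR x := if_neg hx
    rw [hf, bcnfInv, if_neg (by simpa [halfMap] using h)]
    ext i
    fin_cases i <;> simp [halfMap, halfMapInv] <;> field_simp <;> ring

theorem bcnf_bcnfInv (τL τR : ℝ) {δL δR : ℝ} (hL : 0 < δL) (hR : 0 < δR) :
    Function.RightInverse (bcnfInv τL δL τR δR) (bcnf τL δL τR δR) := by
  intro y
  by_cases hy : 0 ≤ y 1
  · have h : -y 1 / δL ≤ 0 := div_nonpos_of_nonpos_of_nonneg (by linarith) hL.le
    have hf : bcnfInv τL δL τR δR y = halfMapInv τL δL y := if_pos hy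
    rw [hf, bcnf, if_pos (by simpa [halfMapInv] using h)]
    ext i
    fin_cases i <;> simp [halfMap, halfMapInv] <;> field_simp <;> ring
  · have h : ¬ -y 1 / δR ≤ 0 := by
      push Not at hy ⊢
      exact div_pos (by linarith) hR
    have hf : bcnfInv τL δL τR δR y = halfMapInv τR δR y := if_neg hy
    rw [hf, bcnf, if_neg (by simpa [halfMapInv] using h)]
    ext i
    fin_cases i <;> simp [halfMap, halfMapInv] <;> field_simp <;> ring

/-- The closed left half-plane `Π_L`. -/
def leftHalfPlane : Set Plane := {x | x 0 ≤ 0}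

/-- The closed right half-plane `Π_R`. -/
def rightHalfPlane : Set Plane := {x | 0 ≤ x 0}

/-- The switching manifold `Σ`, the line `x₁ = 0`. -/
def switchingManifold : Set Plane := {x | x 0 = 0}

/-- `P` lies above the (non-vertical) line `l`: the point of `l` on the same vertical line as `P`
has a smaller second coordinate. -/
def LiesAboveLine (P : Plane) (l : AffineSubspace ℝ Plane) : Prop :=
  ∃ Q ∈ l, Q 0 = P 0 ∧ Q 1 < P 1

/-- `P` lies to the right of the (non-horizontal) line `l`: the point of `l` on the same
horizontal line as `P` has a smaller first coordinate. -/
def LiesRightOfLine (P : Plane) (l : AffineSubspace ℝ Plane) : Prop :=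
  ∃ Q ∈ l, Q 1 = P 1 ∧ Q 0 < P 0

/-- `P` lies above the point `Q`, on the same vertical line. -/
def LiesAbovePoint (P Q : Plane) : Prop :=
  Q 0 = P 0 ∧ Q 1 < P 1

/-- The closed polygonal chain that connects `P 0, P 1, …, P (n - 1)` in order, and then
`P (n - 1)` back to `P 0`. -/
def closedChain (n : ℕ) (P : ℕ → Plane) : Set Plane :=
  ⋃ j ∈ Finset.range n, segment ℝ (P j) (P ((j + 1) % n))

/-- A closed polygonal chain together with the region that it encloses: the points of the
chain and the points whose connected component in the complement of the chain is bounded. -/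
def filledPolygon (n : ℕ) (P : ℕ → Plane) : Set Plane :=
  closedChain n P ∪
    {x | x ∉ closedChain n P ∧
      Bornology.IsBounded (connectedComponentIn (closedChain n P)ᶜ x)}

/-- The sequence of points
`U, f⁻⁽ˡ⁻²⁾(X), …, f⁻¹(X), X, f(X), …, fʳ⁻¹(X), fʳ(X)`, numbered `0, …, l + r - 1`
(here `l ≥ 2`): for `1 ≤ j ≤ l - 1` the `j`-th point is `f⁻⁽ˡ⁻¹⁻ʲ⁾(X)`, and for
`j ≥ l - 1` it is `f^(j - (l - 1)) (X)`. Here `g` is the inverse of `f`. -/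
def omegaVertex (f g : Plane → Plane) (X U : Plane) (l j : ℕ) : Plane :=
  if j = 0 then U
  else if j ≤ l - 1 then g^[l - 1 - j] X
  else f^[j - (l - 1)] X

/-- The polygon `Ω`: the closed polygonal chain through the `l + r` points of `omegaVertex`
and its interior. -/
def omegaPolygon (f g : Plane → Plane) (X U : Plane) (l r : ℕ) : Set Plane :=
  filledPolygon (l + r) (omegaVertex f g X U l)

/-- `S` is forward invariant under `f`. -/
def ForwardInvariant (f : Plane → Plane) (S : Set Plane) : Prop :=
  f '' S ⊆ S

/-- `S` is a trapping region for `f`. -/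
def IsTrappingRegion (f : Plane → Plane) (S : Set Plane) : Prop :=
  IsCompact S ∧ f '' S ⊆ interior S

/-! The polygon `Ω` is star-shaped about the origin. It is therefore described by a gauge: each
sector between consecutive vertices `Q j` and `Q (j + 1)` gives coordinates `s, t ≥ 0`, and `Ω` is
the set where `s + t ≤ 1`. This settles the topology without the Jordan curve theorem. Rays from the
origin show that the filled polygon is this hull, and that a homeomorphism sending the boundary into
the hull sends all of it into the hull (`IsStar.image_subset`).

That the vertices wind clockwise about the origin (`cross < 0`) and that the orbit only turns
clockwise (`orient < 0`) is a property of orbits of one affine map with determinant `δ > 0`. Such a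
map multiplies `orient` by `δ`, so all turns of an orbit have the same sign. The wrong sign, or
winding the wrong way, would prevent the orbit from reaching the vertical axis as it does.

Invariance is then checked edge by edge. Every edge other than the last two is mapped into the next
one. The edge ending at `Z` is cut at `Y`, where the map changes, and the closing edge runs from `Z`
to `U`. The three position hypotheses are used exactly here: they place `f(Y)` to the right of `U`
on the horizontal axis and `f(Z)` strictly inside all upper edges. So the images of these two edges
are interior, except possibly for points sent to `Z` or into the edge after `[U, f(V)]`.

Hence every boundary point moves along the edges and enters the interior within a bounded number of
steps (`OrbitPolygon.iterate_mem_interior`). For a compact forward invariant set with this property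
that is the closure of its interior, finite unions of iterates of slightly smaller compact sets are
trapping regions (`exists_trappingRegion`). -/

open Set Topology

/-! ### Cross products and the gauge of a polygonal arc in a half-plane -/

/-- The planar cross product. -/
def cross (p q : Plane) : ℝ := p 0 * q 1 - p 1 * q 0

/-- Twice the signed area of the triangle `a b c`; negative for clockwise triangles. -/
def orient (a b c : Plane) : ℝ := cross a b + cross b c + cross c a

theorem plane_ext {p q : Plane} (h0 : p 0 = q 0) (h1 : p 1 = q 1) : p = q := by
  ext i
  fin_cases i
  · exact h0
  · exact h1

theorem eq_smul_add_smul_of_cross_ne {a b : Plane} (h : cross a b ≠ 0) (p : Plane) :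
    p = (cross p b / cross a b) • a + (cross a p / cross a b) • b := by
  apply plane_ext <;>
    simp only [PiLp.add_apply, PiLp.smul_apply, smul_eq_mul] <;>
    rw [div_mul_eq_mul_div, div_mul_eq_mul_div, ← add_div, eq_div_iff h] <;>
    simp only [cross] <;> ring

/-- The point `p` has coordinates `s, t ≥ 0` in the sector spanned by `Q j` and `Q (j + 1)`. -/
def InSector (Q : ℕ → Plane) (j : ℕ) (s t : ℝ) (p : Plane) : Prop :=
  0 ≤ s ∧ 0 ≤ t ∧ p = s • Q j + t • Q (j + 1)

/-- A clockwise chain of points in the closed upper half-plane, from the negative to the positive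
half of the horizontal axis. -/
structure UpperArc (Q : ℕ → Plane) (N : ℕ) : Prop where
  left0 : Q 0 0 < 0
  left1 : Q 0 1 = 0
  right0 : 0 < Q N 0
  right1 : Q N 1 = 0
  pos : ∀ j, 0 < j → j < N → 0 < Q j 1
  turn : ∀ j, j < N → cross (Q j) (Q (j + 1)) < 0

namespace UpperArc

variable {Q : ℕ → Plane} {N : ℕ}

theorem nonneg (h : UpperArc Q N) {j : ℕ} (hj : j ≤ N) : 0 ≤ Q j 1 := by
  rcases Nat.eq_zero_or_pos j with rfl | h0
  · exact h.left1.ge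
  rcases hj.eq_or_lt with rfl | h1
  · exact h.right1.ge
  · exact (h.pos j h0 h1).le

theorem zero_lt (h : UpperArc Q N) : 0 < N := by
  rcases Nat.eq_zero_or_pos N with rfl | h0
  · exact absurd h.left0 h.right0.not_gt
  · exact h0

theorem one_lt (h : UpperArc Q N) : 1 < N := by
  by_contra hN
  obtain rfl : N = 1 := by have := h.zero_lt; omega
  have := h.turn 0 one_pos
  simp [cross, h.left1, h.right1] at this

/-- The clockwise turns add up to less than a half turn, unless both ends of the arc are involved.
The induction rests on the three-term identity `key` between cross products and heights. -/
theorem cross_neg (h : UpperArc Q N) {i j : ℕ} (hij : i < j) (hj : j ≤ N)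
    (hne : 0 < i ∨ j < N) : cross (Q i) (Q j) < 0 := by
  induction j, hij using Nat.le_induction with
  | base => exact h.turn i (by omega)
  | succ j hij ih =>
    have h1 := ih (by omega) (Or.inr (by omega))
    have h2 := h.turn j (by omega)
    have hy := h.pos j (by omega) (by omega)
    have key : Q j 1 * cross (Q i) (Q (j + 1)) =
        Q i 1 * cross (Q j) (Q (j + 1)) + Q (j + 1) 1 * cross (Q i) (Q j) := by
      simp only [cross]; ring
    have h3 : Q j 1 * cross (Q i) (Q (j + 1)) < 0 := by
      rw [key]
      rcases hne with hi | hj'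
      · have a := mul_neg_of_pos_of_neg (h.pos i hi (by omega)) h2
        have b := mul_nonpos_of_nonneg_of_nonpos (h.nonneg hj) h1.le
        linarith
      · have a := mul_nonpos_of_nonneg_of_nonpos (h.nonneg (j := i) (by omega)) h2.le
        have b := mul_neg_of_pos_of_neg (h.pos (j + 1) (by omega) hj') h1
        linarith
    exact neg_of_mul_neg_right h3 hy.le

theorem cross_nonpos (h : UpperArc Q N) {i j : ℕ} (hij : i ≤ j) (hj : j ≤ N) :
    cross (Q i) (Q j) ≤ 0 := by
  rcases hij.eq_or_lt with rfl | hlt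
  · simp [cross, mul_comm]
  by_cases hne : 0 < i ∨ j < N
  · exact (h.cross_neg hlt hj hne).le
  · push Not at hne
    obtain rfl : i = 0 := by omega
    obtain rfl : j = N := by omega
    simp [cross, h.left1, h.right1]

/-- The sector ends at the first vertex `Q k` with `k > 0` that `p` does not lie clockwise of; the
last vertex always qualifies. -/
theorem exists_sector (h : UpperArc Q N) {p : Plane} (hp : 0 ≤ p 1) :
    ∃ j < N, ∃ s t, InSector Q j s t p := by
  have hex : ∃ j, 0 < j ∧ 0 ≤ cross (Q j) p :=
    ⟨N, h.zero_lt, by simp [cross, h.right1]; exact mul_nonneg h.right0.le hp⟩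
  classical
  obtain ⟨h0, h1⟩ := Nat.find_spec hex
  have hkN : Nat.find hex ≤ N := Nat.find_min' hex
    ⟨h.zero_lt, by simp [cross, h.right1]; exact mul_nonneg h.right0.le hp⟩
  obtain ⟨j, hjk⟩ : ∃ j, Nat.find hex = j + 1 := ⟨Nat.find hex - 1, by omega⟩
  rw [hjk] at h0 h1 hkN
  have hj : cross (Q j) p ≤ 0 := by
    rcases Nat.eq_zero_or_pos j with rfl | hj0
    · simp [cross, h.left1]; exact mul_nonpos_of_nonpos_of_nonneg h.left0.le hp
    · by_contra hc
      exact Nat.find_min hex (m := j) (by omega) ⟨hj0, (not_le.mp hc).le⟩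
  have ht := h.turn j (by omega)
  have hanti : cross p (Q (j + 1)) = - cross (Q (j + 1)) p := by simp only [cross]; ring
  exact ⟨j, by omega, _, _, div_nonneg_of_nonpos (by linarith) ht.le,
    div_nonneg_of_nonpos hj ht.le, eq_smul_add_smul_of_cross_ne ht.ne p⟩

/-- Different sectors meet only in a common bounding ray or at the origin: `cross p (Q (i + 1))` is
nonpositive by the first representation and nonnegative by the second, so the outer coefficients
vanish. -/
theorem sum_eq_of_lt (h : UpperArc Q N) {i j : ℕ} (hij : i < j) (hj : j < N) {s t s' t' : ℝ}
    {p : Plane} (hi : InSector Q i s t p) (hj' : InSector Q j s' t' p) : s + t = s' + t' := by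
  obtain ⟨hs, ht, e⟩ := hi
  obtain ⟨hs', ht', e'⟩ := hj'
  have ha := h.turn i (by omega)
  have hb := h.cross_nonpos (i := i + 1) (j := j) hij hj.le
  have hc := h.cross_neg (i := i + 1) (j := j + 1) (by omega) (by omega) (by omega)
  have hy := h.pos (i + 1) (by omega) (by omega)
  have k1 : cross p (Q (i + 1)) = s * cross (Q i) (Q (i + 1)) := by
    rw [e]; simp [cross]; ring
  have k2 : cross p (Q (i + 1)) =
      -(s' * cross (Q (i + 1)) (Q j) + t' * cross (Q (i + 1)) (Q (j + 1))) := by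
    rw [e']; simp [cross]; ring
  have m1 := mul_nonpos_of_nonneg_of_nonpos hs ha.le
  have m2 := mul_nonpos_of_nonneg_of_nonpos hs' hb
  have m3 := mul_nonpos_of_nonneg_of_nonpos ht' hc.le
  have s0 : s = 0 := by
    have : s * cross (Q i) (Q (i + 1)) = 0 := by linarith
    exact (mul_eq_zero.mp this).resolve_right ha.ne
  have t0 : t' = 0 := by
    have : t' * cross (Q (i + 1)) (Q (j + 1)) = 0 := by linarith
    exact (mul_eq_zero.mp this).resolve_right hc.ne
  have y1 : p 1 = t * Q (i + 1) 1 := by rw [e, s0]; simp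
  have y2 : p 1 = s' * Q j 1 := by rw [e', t0]; simp
  rcases (show i + 1 ≤ j from hij).eq_or_lt with rfl | hlt
  · have : t = s' := mul_right_cancel₀ hy.ne' (y1.symm.trans y2)
    rw [s0, t0, this]; ring
  · have hb' := h.cross_neg (i := i + 1) (j := j) hlt hj.le (by omega)
    have s0' : s' = 0 := by
      have : s' * cross (Q (i + 1)) (Q j) = 0 := by linarith
      exact (mul_eq_zero.mp this).resolve_right hb'.ne
    have t0' : t = 0 := by
      rw [s0', zero_mul] at y2
      exact (mul_eq_zero.mp (y1.symm.trans y2)).resolve_right hy.ne'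
    rw [s0, t0, s0', t0']

theorem sum_eq (h : UpperArc Q N) {i j : ℕ} (hi : i < N) (hj : j < N) {s t s' t' : ℝ}
    {p : Plane} (h1 : InSector Q i s t p) (h2 : InSector Q j s' t' p) : s + t = s' + t' := by
  rcases lt_trichotomy i j with hlt | rfl | hlt
  · exact h.sum_eq_of_lt hlt hj h1 h2
  · have ht := (h.turn i hi).ne
    have e := h1.2.2.symm.trans h2.2.2
    have e1 : s * cross (Q i) (Q (i + 1)) = s' * cross (Q i) (Q (i + 1)) := by
      have := congrArg (fun q => cross q (Q (i + 1))) e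
      simp only [cross, PiLp.add_apply, PiLp.smul_apply, smul_eq_mul] at this ⊢
      linear_combination this
    have e2 : t * cross (Q i) (Q (i + 1)) = t' * cross (Q i) (Q (i + 1)) := by
      have := congrArg (fun q => cross (Q i) q) e
      simp only [cross, PiLp.add_apply, PiLp.smul_apply, smul_eq_mul] at this ⊢
      linear_combination this
    rw [mul_right_cancel₀ ht e1, mul_right_cancel₀ ht e2]
  · exact (h.sum_eq_of_lt hlt hi h2 h1).symm

/-- On the horizontal axis the gauge only depends on the two end points of the arc. -/
theorem sum_eq_max (h : UpperArc Q N) {j : ℕ} (hj : j < N) {s t : ℝ} {p : Plane}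
    (hp : p 1 = 0) (h1 : InSector Q j s t p) : s + t = max (p 0 / Q 0 0) (p 0 / Q N 0) := by
  obtain ⟨hs, ht, e⟩ := h1
  have y : s * Q j 1 + t * Q (j + 1) 1 = 0 := by rw [← hp, e]; simp
  have a := mul_nonneg hs (h.nonneg hj.le)
  have b := mul_nonneg ht (h.nonneg (j := j + 1) hj)
  have sy : s = 0 ∨ j = 0 := by
    by_contra hc
    push Not at hc
    have := mul_ne_zero hc.1 (h.pos j (by omega) hj).ne'
    exact this (by linarith)
  have ty : t = 0 ∨ j + 1 = N := by
    by_contra hc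
    push Not at hc
    have := mul_ne_zero hc.1 (h.pos (j + 1) (by omega) (by omega)).ne'
    exact this (by linarith)
  have l0 := h.left0
  have r0 := h.right0
  have hN := h.one_lt
  rcases ty with rfl | hjN
  · rcases sy with rfl | rfl
    · have : p 0 = 0 := by rw [e]; simp
      simp [this]
    · have : p 0 = s * Q 0 0 := by rw [e]; simp
      rw [this, mul_div_cancel_right₀ _ l0.ne, max_eq_left, add_zero]
      exact (div_nonpos_of_nonpos_of_nonneg
        (mul_nonpos_of_nonneg_of_nonpos hs l0.le) r0.le).trans hs
  · have hs0 : s = 0 := sy.resolve_right (by omega)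
    subst hs0
    have : p 0 = t * Q N 0 := by rw [e, hjN]; simp
    rw [this, mul_div_cancel_right₀ _ r0.ne', max_eq_right, zero_add]
    exact (div_nonpos_of_nonneg_of_nonpos (mul_nonneg ht r0.le) l0.le).trans ht

end UpperArc

/-! ### Star-shaped polygons and their topology -/

/-- A closed polygon, star-shaped about the origin: `Q 0, …, Q l` is a clockwise chain in the upper
half-plane, and `Q l, …, Q (l + m) = Q 0` is a clockwise chain in the lower half-plane. -/
structure IsStar (Q : ℕ → Plane) (l m : ℕ) : Prop where
  upper : UpperArc Q l
  lower : UpperArc (fun j => -Q (l + j)) m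
  closed : Q (l + m) = Q 0

/-- The points whose gauge with respect to the chain `Q 0, …, Q n` is less than `1`. -/
def starInterior (Q : ℕ → Plane) (n : ℕ) : Set Plane :=
  {p | ∃ j < n, ∃ s t, InSector Q j s t p ∧ s + t < 1}

/-- The points whose gauge with respect to the chain `Q 0, …, Q n` is at most `1`. -/
def starHull (Q : ℕ → Plane) (n : ℕ) : Set Plane :=
  {p | ∃ j < n, ∃ s t, InSector Q j s t p ∧ s + t ≤ 1}

theorem mem_segment_iff_inSector {Q : ℕ → Plane} {j : ℕ} {p : Plane} :
    p ∈ segment ℝ (Q j) (Q (j + 1)) ↔ ∃ s t, InSector Q j s t p ∧ s + t = 1 := by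
  constructor
  · rintro ⟨s, t, hs, ht, hst, rfl⟩
    exact ⟨s, t, ⟨hs, ht, rfl⟩, hst⟩
  · rintro ⟨s, t, ⟨hs, ht, rfl⟩, hst⟩
    exact ⟨s, t, hs, ht, hst, rfl⟩

theorem InSector.smul {Q : ℕ → Plane} {j : ℕ} {s t : ℝ} {p : Plane} (h : InSector Q j s t p)
    {c : ℝ} (hc : 0 ≤ c) : InSector Q j (c * s) (c * t) (c • p) := by
  obtain ⟨hs, ht, rfl⟩ := h
  exact ⟨mul_nonneg hc hs, mul_nonneg hc ht, by rw [smul_add, smul_smul, smul_smul]⟩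

theorem isCompact_starHull (Q : ℕ → Plane) (n : ℕ) : IsCompact (starHull Q n) := by
  have hT : IsCompact {x : ℝ × ℝ | 0 ≤ x.1 ∧ 0 ≤ x.2 ∧ x.1 + x.2 ≤ 1} := by
    apply (isCompact_Icc (a := (0 : ℝ × ℝ)) (b := 1)).of_isClosed_subset
    · exact (isClosed_le continuous_const continuous_fst).inter
        ((isClosed_le continuous_const continuous_snd).inter
          (isClosed_le (continuous_fst.add continuous_snd) continuous_const))
    · rintro ⟨a, b⟩ ⟨h1, h2, h3⟩
      simp only at h1 h2 h3
      exact ⟨⟨h1, h2⟩, ⟨by simp only [Prod.fst_one]; linarith, by simp only [Prod.snd_one]; linarith⟩⟩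
  have : starHull Q n = ⋃ j ∈ Finset.range n, (fun x : ℝ × ℝ => x.1 • Q j + x.2 • Q (j + 1)) ''
      {x : ℝ × ℝ | 0 ≤ x.1 ∧ 0 ≤ x.2 ∧ x.1 + x.2 ≤ 1} := by
    ext p
    simp only [starHull, mem_ofPred_eq, mem_iUnion, Finset.mem_range, mem_image, Prod.exists,
      InSector, exists_prop]
    constructor
    · rintro ⟨j, hj, s, t, ⟨hs, ht, rfl⟩, hst⟩
      exact ⟨j, hj, s, t, ⟨hs, ht, hst⟩, rfl⟩
    · rintro ⟨j, hj, s, t, ⟨hs, ht, hst⟩, rfl⟩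
      exact ⟨j, hj, s, t, ⟨hs, ht, rfl⟩, hst⟩
  rw [this]
  exact (Finset.range n).isCompact_biUnion fun j _ =>
    hT.image ((continuous_fst.smul continuous_const).add (continuous_snd.smul continuous_const))

theorem starInterior_subset_starHull (Q : ℕ → Plane) (n : ℕ) :
    starInterior Q n ⊆ starHull Q n := by
  rintro p ⟨j, hj, s, t, h, hst⟩
  exact ⟨j, hj, s, t, h, hst.le⟩

theorem starHull_subset_closure (Q : ℕ → Plane) (n : ℕ) :
    starHull Q n ⊆ closure (starInterior Q n) := by
  rintro p ⟨j, hj, s, t, h, hst⟩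
  have h1 : (1 : ℝ) ∈ closure (Ico (0 : ℝ) 1) := by
    rw [closure_Ico (by norm_num)]; exact ⟨zero_le_one, le_rfl⟩
  have hc : Continuous fun c : ℝ => c • p := continuous_id.smul continuous_const
  have := map_mem_closure hc h1 (t := starInterior Q n) (by
    rintro c ⟨hc0, hc1⟩
    refine ⟨j, hj, _, _, h.smul hc0, ?_⟩
    have := h.1
    have := h.2.1
    nlinarith)
  simpa using this

theorem closedChain_eq {Q : ℕ → Plane} {n : ℕ} (P : ℕ → Plane) (hQ : ∀ j, Q j = P (j % n)) :
    closedChain n P = {p | ∃ j < n, ∃ s t, InSector Q j s t p ∧ s + t = 1} := by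
  ext p
  simp only [closedChain, mem_iUnion, Finset.mem_range, exists_prop, mem_ofPred_eq]
  refine exists_congr fun j => and_congr_right fun hj => ?_
  rw [← mem_segment_iff_inSector, hQ, hQ, Nat.mod_eq_of_lt hj]

namespace IsStar

variable {Q : ℕ → Plane} {l m : ℕ}

theorem inSector_neg {j : ℕ} {s t : ℝ} {p : Plane} :
    InSector (fun j => -Q (l + j)) j s t (-p) ↔ InSector Q (l + j) s t p := by
  unfold InSector
  simp only [smul_neg]
  rw [← neg_add, neg_inj]
  rfl

theorem turn (h : IsStar Q l m) {j : ℕ} (hj : j < l + m) : cross (Q j) (Q (j + 1)) < 0 := by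
  rcases lt_or_ge j l with h1 | h1
  · exact h.upper.turn j h1
  · obtain ⟨k, rfl⟩ := Nat.exists_eq_add_of_le h1
    have := h.lower.turn k (by omega)
    simpa [cross, add_assoc] using this

theorem exists_upper_sector (h : IsStar Q l m) {p : Plane} (hp : 0 ≤ p 1) :
    ∃ j < l, ∃ s t, InSector Q j s t p := h.upper.exists_sector hp

theorem exists_lower_sector (h : IsStar Q l m) {p : Plane} (hp : p 1 ≤ 0) :
    ∃ j, l ≤ j ∧ j < l + m ∧ ∃ s t, InSector Q j s t p := by
  obtain ⟨j, hj, s, t, hst⟩ := h.lower.exists_sector (p := -p) (by simpa using hp)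
  exact ⟨l + j, by omega, by omega, s, t, inSector_neg.mp hst⟩

theorem exists_sector (h : IsStar Q l m) (p : Plane) :
    ∃ j < l + m, ∃ s t, InSector Q j s t p := by
  rcases le_total 0 (p 1) with hp | hp
  · obtain ⟨j, hj, H⟩ := h.exists_upper_sector hp
    exact ⟨j, by omega, H⟩
  · obtain ⟨j, -, hj, H⟩ := h.exists_lower_sector hp
    exact ⟨j, hj, H⟩

/-- An upper and a lower sector meet only on the horizontal axis. There both gauges are given by
`sum_eq_max`, and the two arcs share their end points. -/
theorem sum_eq_of_lt_of_le (h : IsStar Q l m) {i j : ℕ} (hi : i < l) (hlj : l ≤ j)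
    (hj : j < l + m) {s t s' t' : ℝ} {p : Plane} (h1 : InSector Q i s t p)
    (h2 : InSector Q j s' t' p) : s + t = s' + t' := by
  obtain ⟨k, rfl⟩ := Nat.exists_eq_add_of_le hlj
  have hk : k < m := by omega
  have h2' := inSector_neg.mpr h2
  have y1 : 0 ≤ p 1 := by
    rw [h1.2.2]
    simpa using add_nonneg (mul_nonneg h1.1 (h.upper.nonneg hi.le))
      (mul_nonneg h1.2.1 (h.upper.nonneg (j := i + 1) hi))
  have y2 : 0 ≤ (-p) 1 := by
    rw [h2'.2.2]
    simpa only [PiLp.add_apply, PiLp.smul_apply, smul_eq_mul] using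
      add_nonneg (mul_nonneg h2.1 (h.lower.nonneg hk.le))
        (mul_nonneg h2.2.1 (h.lower.nonneg (j := k + 1) hk))
  have y0 : p 1 = 0 := le_antisymm (by simpa using y2) y1
  rw [h.upper.sum_eq_max hi y0 h1, h.lower.sum_eq_max hk (by simpa using y0) h2', max_comm]
  simp [h.closed]

theorem sum_eq (h : IsStar Q l m) {i j : ℕ} (hi : i < l + m) (hj : j < l + m)
    {s t s' t' : ℝ} {p : Plane} (h1 : InSector Q i s t p) (h2 : InSector Q j s' t' p) :
    s + t = s' + t' := by
  rcases lt_or_ge i l with hil | hil <;> rcases lt_or_ge j l with hjl | hjl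
  · exact h.upper.sum_eq hil hjl h1 h2
  · exact h.sum_eq_of_lt_of_le hil hjl hj h1 h2
  · exact (h.sum_eq_of_lt_of_le hjl hil hi h2 h1).symm
  · obtain ⟨i, rfl⟩ := Nat.exists_eq_add_of_le hil
    obtain ⟨j, rfl⟩ := Nat.exists_eq_add_of_le hjl
    exact h.lower.sum_eq (by omega) (by omega) (inSector_neg.mpr h1) (inSector_neg.mpr h2)

/-- Since the gauge does not depend on the sector, the complement is the finite union of the closed
pieces of the sectors where the gauge is at least `1`. -/
theorem isOpen_starInterior (h : IsStar Q l m) : IsOpen (starInterior Q (l + m)) := by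
  have hc1 : ∀ q : Plane, Continuous fun p : Plane => cross p q := fun q => by
    unfold cross; fun_prop
  have hc2 : ∀ q : Plane, Continuous fun p : Plane => cross q p := fun q => by
    unfold cross; fun_prop
  have : (starInterior Q (l + m))ᶜ = ⋃ j ∈ Finset.range (l + m),
      {p | 0 ≤ cross p (Q (j + 1)) / cross (Q j) (Q (j + 1)) ∧
        0 ≤ cross (Q j) p / cross (Q j) (Q (j + 1)) ∧
        1 ≤ cross p (Q (j + 1)) / cross (Q j) (Q (j + 1)) +
          cross (Q j) p / cross (Q j) (Q (j + 1))} := by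
    ext p
    simp only [mem_compl_iff, mem_iUnion, Finset.mem_range, exists_prop, mem_ofPred_eq]
    constructor
    · intro hp
      obtain ⟨j, hj, s, t, hs, ht, e⟩ := h.exists_sector p
      have hne := (h.turn hj).ne
      have es : cross p (Q (j + 1)) / cross (Q j) (Q (j + 1)) = s := by
        rw [div_eq_iff hne, e]; simp [cross]; ring
      have et : cross (Q j) p / cross (Q j) (Q (j + 1)) = t := by
        rw [div_eq_iff hne, e]; simp [cross]; ring
      refine ⟨j, hj, ?_⟩
      rw [es, et]
      exact ⟨hs, ht, not_lt.mp fun hlt => hp ⟨j, hj, s, t, ⟨hs, ht, e⟩, hlt⟩⟩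
    · rintro ⟨j, hj, hs, ht, hst⟩ ⟨i, hi, s, t, h1, hlt⟩
      have := h.sum_eq hi hj h1
        ⟨hs, ht, eq_smul_add_smul_of_cross_ne (h.turn hj).ne p⟩
      linarith
  rw [← isClosed_compl_iff, this]
  refine (Finset.range (l + m)).finite_toSet.isClosed_biUnion fun j _ => ?_
  exact (isClosed_le continuous_const ((hc1 _).div_const _)).inter
    ((isClosed_le continuous_const ((hc2 _).div_const _)).inter
      (isClosed_le continuous_const (((hc1 _).div_const _).add ((hc2 _).div_const _))))

theorem one_lt_of_notMem (h : IsStar Q l m) {p : Plane} (hp : p ∉ starHull Q (l + m)) :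
    ∃ j < l + m, ∃ s t, InSector Q j s t p ∧ 1 < s + t := by
  obtain ⟨j, hj, s, t, H⟩ := h.exists_sector p
  exact ⟨j, hj, s, t, H, not_le.mp fun hle => hp ⟨j, hj, s, t, H, hle⟩⟩

/-- The ray from a point outside of a star-shaped polygon away from the origin. -/
theorem smul_notMem_starHull (h : IsStar Q l m) {p : Plane} (hp : p ∉ starHull Q (l + m))
    {c : ℝ} (hc : 1 ≤ c) : c • p ∉ starHull Q (l + m) := by
  obtain ⟨j, hj, s, t, H, hst⟩ := h.one_lt_of_notMem hp
  rintro ⟨i, hi, s', t', H', hst'⟩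
  have := h.sum_eq hi hj H' (H.smul (c := c) (by linarith))
  nlinarith

theorem isPreconnected_ray (p : Plane) : IsPreconnected ((fun c : ℝ => c • p) '' Ici 1) :=
  isPreconnected_Ici.image _ (by fun_prop)

theorem zero_mem_starInterior (h : IsStar Q l m) : (0 : Plane) ∈ starInterior Q (l + m) := by
  refine ⟨0, ?_, 0, 0, ⟨le_rfl, le_rfl, by simp⟩, by norm_num⟩
  have := h.upper.zero_lt
  omega

theorem not_isBounded_ray {p : Plane} (hp : p ≠ 0) :
    ¬ Bornology.IsBounded ((fun c : ℝ => c • p) '' Ici 1) := by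
  intro hb
  obtain ⟨C, hC⟩ := hb.exists_norm_le
  have hp' : 0 < ‖p‖ := norm_pos_iff.mpr hp
  have := hC _ ⟨max 1 ((C + 1) / ‖p‖), mem_Ici.mpr (le_max_left _ _), rfl⟩
  simp only [norm_smul, Real.norm_eq_abs] at this
  have h1 : (C + 1) / ‖p‖ ≤ |max 1 ((C + 1) / ‖p‖)| := (le_max_right _ _).trans (le_abs_self _)
  have h2 := mul_le_mul_of_nonneg_right h1 hp'.le
  rw [div_mul_cancel₀ _ hp'.ne'] at h2
  linarith

/-- A point outside the hull escapes to infinity along its ray without meeting the chain. The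
component of an inner point cannot leave the open set `starInterior`, whose closure adds only points
of the chain. -/
theorem filledPolygon_eq (h : IsStar Q l m) {P : ℕ → Plane}
    (hQ : ∀ j, Q j = P (j % (l + m))) : filledPolygon (l + m) P = starHull Q (l + m) := by
  have hch := closedChain_eq P hQ
  have hsub : closedChain (l + m) P ⊆ starHull Q (l + m) := by
    rw [hch]
    rintro p ⟨j, hj, s, t, H, hst⟩
    exact ⟨j, hj, s, t, H, hst.le⟩
  apply Subset.antisymm
  · rintro p (hp | ⟨hp, hb⟩)
    · exact hsub hp
    · by_contra hnot
      have hp0 : p ≠ 0 := by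
        rintro rfl
        exact hnot (starInterior_subset_starHull _ _ h.zero_mem_starInterior)
      refine not_isBounded_ray hp0 (hb.subset ?_)
      apply (isPreconnected_ray p).subset_connectedComponentIn
      · exact ⟨1, (mem_Ici.mpr le_rfl), one_smul _ _⟩
      · rintro _ ⟨c, hc, rfl⟩ hmem
        exact h.smul_notMem_starHull hnot hc (hsub hmem)
  · rintro p hp
    by_cases hpc : p ∈ closedChain (l + m) P
    · exact Or.inl hpc
    have hK : ∀ q ∈ starHull Q (l + m), q ∉ closedChain (l + m) P →
        q ∈ starInterior Q (l + m) := by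
      rintro q ⟨j, hj, s, t, H, hst⟩ hq
      refine ⟨j, hj, s, t, H, lt_of_le_of_ne hst fun he => hq ?_⟩
      rw [hch]
      exact ⟨j, hj, s, t, H, he⟩
    refine Or.inr ⟨hpc, (isCompact_starHull Q (l + m)).isBounded.subset
      (Subset.trans ?_ (starInterior_subset_starHull _ _))⟩
    apply isPreconnected_connectedComponentIn.subset_of_closure_inter_subset h.isOpen_starInterior
    · exact ⟨p, mem_connectedComponentIn hpc, hK p hp hpc⟩
    · rintro q ⟨hq, hqc⟩
      exact hK q (closure_minimal (starInterior_subset_starHull _ _)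
        (isCompact_starHull Q (l + m)).isClosed hq) (connectedComponentIn_subset _ _ hqc)

theorem starInterior_subset_interior (h : IsStar Q l m) :
    starInterior Q (l + m) ⊆ interior (starHull Q (l + m)) :=
  interior_maximal (starInterior_subset_starHull _ _) h.isOpen_starInterior

/-- A homeomorphism that maps the boundary of a star-shaped polygon into the polygon maps the
whole polygon into itself. -/
theorem image_subset (h : IsStar Q l m) (e : Plane ≃ₜ Plane)
    (he : ∀ j < l + m, ∀ p ∈ segment ℝ (Q j) (Q (j + 1)), e p ∈ starHull Q (l + m)) :
    e '' starHull Q (l + m) ⊆ starHull Q (l + m) := by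
  rintro _ ⟨p, hp, rfl⟩
  by_contra hnot
  have hp0 : e p ≠ 0 := by
    intro h0
    rw [h0] at hnot
    exact hnot (starInterior_subset_starHull _ _ h.zero_mem_starInterior)
  -- The ray `R` avoids the polygon, so its preimage avoids the boundary. Being connected and
  -- containing `p`, the preimage stays in the interior; then `R` would be bounded.
  set R := (fun c : ℝ => c • e p) '' Ici 1 with hR
  have hRK : ∀ q ∈ R, q ∉ starHull Q (l + m) := by
    rintro _ ⟨c, hc, rfl⟩
    exact h.smul_notMem_starHull hnot hc
  have hmem : ∀ q, q ∈ starHull Q (l + m) → e q ∈ R → q ∈ starInterior Q (l + m) := by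
    rintro q ⟨j, hj, s, t, H, hst⟩ hq
    refine ⟨j, hj, s, t, H, lt_of_le_of_ne hst fun heq => hRK _ hq (he j hj q ?_)⟩
    exact mem_segment_iff_inSector.mpr ⟨s, t, H, heq⟩
  have hpR : e p ∈ R := ⟨1, (mem_Ici.mpr le_rfl), one_smul _ _⟩
  have hconn : IsPreconnected (e.symm '' R) :=
    (isPreconnected_ray (e p)).image _ e.symm.continuous.continuousOn
  have hsub : e.symm '' R ⊆ starInterior Q (l + m) := by
    apply hconn.subset_of_closure_inter_subset h.isOpen_starInterior
    · exact ⟨p, ⟨e p, hpR, e.symm_apply_apply p⟩, hmem p hp hpR⟩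
    · rintro _ ⟨hq, r, hr, rfl⟩
      exact hmem _ (closure_minimal (starInterior_subset_starHull _ _)
        (isCompact_starHull Q (l + m)).isClosed hq) (by simpa using hr)
  refine not_isBounded_ray hp0 (((isCompact_starHull Q (l + m)).image e.continuous).isBounded.subset
    fun q hq => ⟨e.symm q, starInterior_subset_starHull _ _ (hsub ⟨q, hq, rfl⟩), by simp⟩)

end IsStar

/-! ### Trapping regions from eventual entry into the interior -/

/-- A forward invariant compact set that is the closure of its interior, and that some iterate
maps into its interior, is approximated from inside by trapping regions. -/
theorem exists_trappingRegion (e : Plane ≃ₜ Plane) {K : Set Plane} (hK : IsCompact K)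
    (hinv : e '' K ⊆ K) (hcl : K ⊆ closure (interior K)) {N : ℕ}
    (hN : ∀ p ∈ K, e^[N] p ∈ interior K) {ε : ℝ} (hε : 0 < ε) :
    ∃ T : Set Plane, IsTrappingRegion e T ∧ T ⊆ K ∧
      Metric.hausdorffEDist K T ≤ ENNReal.ofReal ε := by
  have hcont : ∀ k, Continuous (e^[k]) := fun k => e.continuous.iterate k
  -- a compact subset of the interior that is `ε`-dense in `K`
  obtain ⟨F, hFK, hF⟩ := hK.elim_finite_subcover_image (b := interior K)
    (c := fun x => Metric.ball x ε) (fun _ _ => Metric.isOpen_ball) (by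
      intro p hp
      obtain ⟨q, hq, hpq⟩ := Metric.mem_closure_iff.mp (hcl hp) ε hε
      exact mem_biUnion hq hpq)
  -- Compact sets, each in the interior of the next, starting around the dense finite set `F` and
  -- the image of `K` under the `N`-th iterate.
  have hS : ∃ S : ℕ → Set Plane, (∀ k, IsCompact (S k) ∧ S k ⊆ interior K) ∧
      (∀ k, S k ⊆ interior (S (k + 1))) ∧ F ∪ e^[N] '' K ⊆ interior (S 0) := by
    have step : ∀ C : {C : Set Plane // IsCompact C ∧ C ⊆ interior K},
        ∃ D : {C : Set Plane // IsCompact C ∧ C ⊆ interior K}, C.1 ⊆ interior D.1 := by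
      rintro ⟨C, hC, hCK⟩
      obtain ⟨D, hD, h1, h2⟩ := exists_compact_between hC isOpen_interior hCK
      exact ⟨⟨D, hD, h2⟩, h1⟩
    choose next hnext using step
    have hbase : IsCompact (F ∪ e^[N] '' K) ∧ F ∪ e^[N] '' K ⊆ interior K := by
      refine ⟨hF.1.isCompact.union (hK.image (hcont N)), union_subset hFK ?_⟩
      rintro _ ⟨p, hp, rfl⟩
      exact hN p hp
    refine ⟨fun k => (next^[k + 1] ⟨_, hbase⟩).1, fun k => (next^[k + 1] ⟨_, hbase⟩).2,
      fun k => ?_, hnext ⟨_, hbase⟩⟩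
    have := hnext (next^[k + 1] ⟨_, hbase⟩)
    rwa [← Function.iterate_succ_apply' next] at this
  obtain ⟨S, hSc, hSs, hS0⟩ := hS
  have hKit : ∀ k, e^[k] '' K ⊆ K := by
    intro k
    induction k with
    | zero => simp
    | succ k ih =>
      rw [Function.iterate_succ', image_comp]
      exact (image_mono ih).trans hinv
  have hSK : ∀ k, S k ⊆ K := fun k => (hSc k).2.trans interior_subset
  have himg : ∀ k (A : Set Plane), e^[k] '' interior A ⊆ interior (e^[k] '' A) := by
    intro k A
    induction k with
    | zero => simp
    | succ k ih =>
      rw [Function.iterate_succ', image_comp, image_comp, ← e.image_interior]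
      exact image_mono ih
  -- One application of `e` moves piece `k` into the interior of piece `k + 1`, and piece `N` into
  -- `e^[N] '' K`, hence into the interior of piece `0`.
  refine ⟨⋃ k ∈ Finset.range (N + 1), e^[k] '' S k, ⟨?_, ?_⟩, ?_, ?_⟩
  · exact (Finset.range (N + 1)).isCompact_biUnion fun k _ => (hSc k).1.image (hcont k)
  · rintro _ ⟨q, hq, rfl⟩
    simp only [mem_iUnion, Finset.mem_range, exists_prop] at hq
    obtain ⟨k, hk, p, hp, rfl⟩ := hq
    rcases Nat.lt_or_ge (k + 1) (N + 1) with hk1 | hk1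
    · have h1 : e (e^[k] p) ∈ interior (e^[k + 1] '' S (k + 1)) := by
        rw [← Function.iterate_succ_apply' e k p]
        exact himg _ _ ⟨p, hSs k hp, rfl⟩
      exact interior_mono (subset_biUnion_of_mem (u := fun k => e^[k] '' S k)
        (Finset.mem_coe.mpr (Finset.mem_range.mpr hk1))) h1
    · obtain rfl : k = N := by omega
      have h1 : e (e^[k] p) ∈ interior (S 0) := by
        rw [← Function.iterate_succ_apply' e k p, Function.iterate_succ_apply]
        exact hS0 (Or.inr ⟨e p, hinv ⟨p, hSK _ hp, rfl⟩, rfl⟩)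
      refine interior_mono ?_ h1
      have := subset_biUnion_of_mem (u := fun k => e^[k] '' S k) (s := ↑(Finset.range (k + 1)))
        (x := 0) (by simp)
      simpa using this
  · simp only [iUnion_subset_iff]
    intro k _
    exact (image_mono (hSK k)).trans (hKit k)
  · refine Metric.hausdorffEDist_le_of_mem_edist ?_ ?_
    · intro p hp
      obtain ⟨q, hq, hpq⟩ := mem_iUnion₂.mp (hF.2 hp)
      refine ⟨q, ?_, ?_⟩
      · exact mem_biUnion (x := 0) (by simp)
          ⟨q, interior_subset (hS0 (Or.inl hq)), rfl⟩
      · rw [edist_dist]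
        exact ENNReal.ofReal_le_ofReal (Metric.mem_ball.mp hpq).le
    · intro q hq
      simp only [mem_iUnion] at hq
      obtain ⟨k, -, hq⟩ := hq
      exact ⟨q, hKit k (image_mono (hSK k) hq), by simp⟩

/-! ### Orientation of triangles and convex chains -/

section Orientation

theorem orient_exchange (a b c p : Plane) :
    cross b c * orient a b p = cross a b * orient b c p + cross b p * orient a b c := by
  simp only [orient, cross]; ring

theorem orient_of_inSector {Q : ℕ → Plane} {i : ℕ} {s t : ℝ} {p : Plane}
    (h : InSector Q i s t p) :
    orient (Q i) (Q (i + 1)) p = cross (Q i) (Q (i + 1)) * (1 - s - t) := by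
  rw [h.2.2]; simp [orient, cross]; ring

theorem orient_combo (a b p q : Plane) {s t : ℝ} (hst : s + t = 1) :
    orient a b (s • p + t • q) = s * orient a b p + t * orient a b q := by
  obtain rfl : s = 1 - t := by linarith
  simp [orient, cross]; ring

theorem orient_smul (a b p : Plane) (c : ℝ) :
    orient a b (c • p) = (1 - c) * cross a b + c * orient a b p := by
  simp [orient, cross]; ring

/-- A clockwise chain of points, as seen from the origin, that only turns clockwise. -/
structure ConvexChain (Q : ℕ → Plane) (a b : ℕ) : Prop where
  star : ∀ i, a ≤ i → i < b → cross (Q i) (Q (i + 1)) < 0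
  turn : ∀ i, a ≤ i → i + 1 < b → orient (Q i) (Q (i + 1)) (Q (i + 2)) < 0

namespace ConvexChain

variable {Q : ℕ → Plane} {a b : ℕ}

/-- A point on the inner side of one edge that lies counter-clockwise of the next vertex is on the
inner side of the next edge too. This is a sign count in `orient_exchange`. -/
theorem orient_neg_forward (h : ConvexChain Q a b) {p : Plane} {i j : ℕ} (hai : a ≤ i)
    (hij : i ≤ j) (hjb : j < b) (h0 : orient (Q i) (Q (i + 1)) p < 0)
    (hp : ∀ k, i < k → k ≤ j → 0 ≤ cross (Q k) p) : orient (Q j) (Q (j + 1)) p < 0 := by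
  induction j, hij using Nat.le_induction with
  | base => exact h0
  | succ j hij ih =>
    have h1 := ih (by omega) fun k hk hkj => hp k hk (by omega)
    have h2 := h.star j (by omega) (by omega)
    have h3 := h.star (j + 1) (by omega) hjb
    have h4 := h.turn j (by omega) (by omega)
    have h5 := hp (j + 1) (by omega) le_rfl
    have key := orient_exchange (Q j) (Q (j + 1)) (Q (j + 2)) p
    have m1 := mul_pos_of_neg_of_neg h3 h1
    have m2 := mul_nonpos_of_nonneg_of_nonpos h5 h4.le
    exact neg_of_mul_pos_right (a := cross (Q j) (Q (j + 1))) (by linarith) h2.le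

theorem orient_nonpos_forward (h : ConvexChain Q a b) {p : Plane} {i j : ℕ} (hai : a ≤ i)
    (hij : i ≤ j) (hjb : j < b) (h0 : orient (Q i) (Q (i + 1)) p ≤ 0)
    (hp : ∀ k, i < k → k ≤ j → 0 ≤ cross (Q k) p) : orient (Q j) (Q (j + 1)) p ≤ 0 := by
  induction j, hij using Nat.le_induction with
  | base => exact h0
  | succ j hij ih =>
    have h1 := ih (by omega) fun k hk hkj => hp k hk (by omega)
    have h2 := h.star j (by omega) (by omega)
    have h3 := h.star (j + 1) (by omega) hjb
    have h4 := h.turn j (by omega) (by omega)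
    have h5 := hp (j + 1) (by omega) le_rfl
    have key := orient_exchange (Q j) (Q (j + 1)) (Q (j + 2)) p
    have m1 := mul_nonneg_of_nonpos_of_nonpos h3.le h1
    have m2 := mul_nonpos_of_nonneg_of_nonpos h5 h4.le
    by_contra hc
    have m3 := mul_neg_of_neg_of_pos h2 (not_le.mp hc)
    linarith

theorem orient_nonpos_backward (h : ConvexChain Q a b) {p : Plane} {i j : ℕ} (hai : a ≤ i)
    (hij : i ≤ j) (hjb : j < b) (h0 : orient (Q j) (Q (j + 1)) p ≤ 0)
    (hp : ∀ k, i < k → k ≤ j → cross (Q k) p ≤ 0) : orient (Q i) (Q (i + 1)) p ≤ 0 := by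
  induction j, hij using Nat.le_induction with
  | base => exact h0
  | succ j hij ih =>
    refine ih (by omega) ?_ fun k hk hkj => hp k hk (by omega)
    have h2 := h.star j (by omega) (by omega)
    have h3 := h.star (j + 1) (by omega) hjb
    have h4 := h.turn j (by omega) (by omega)
    have h5 := hp (j + 1) (by omega) le_rfl
    have key := orient_exchange (Q j) (Q (j + 1)) (Q (j + 2)) p
    have m1 := mul_nonneg_of_nonpos_of_nonpos h2.le h0
    have m2 := mul_nonneg_of_nonpos_of_nonpos h5 h4.le
    by_contra hc
    have m3 := mul_neg_of_neg_of_pos h3 (not_le.mp hc)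
    linarith

/-- All vertices of a convex chain that spans at most a half-plane lie on the inner side of all
of its edges. -/
theorem orient_vertex_nonpos (h : ConvexChain Q a b)
    (hc : ∀ i j, a ≤ i → i ≤ j → j ≤ b → cross (Q i) (Q j) ≤ 0) {i k : ℕ} (hai : a ≤ i)
    (hib : i < b) (hak : a ≤ k) (hkb : k ≤ b) : orient (Q i) (Q (i + 1)) (Q k) ≤ 0 := by
  rcases le_or_gt k i with hki | hik
  · refine h.orient_nonpos_forward hak hki hib ?_ fun j hj hji => ?_
    · simp only [orient, cross]; linarith
    · have := hc k j hak hj.le (by omega)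
      simp only [cross] at this ⊢
      linarith
  · obtain ⟨j, rfl⟩ : ∃ j, k = j + 1 := ⟨k - 1, by omega⟩
    refine h.orient_nonpos_backward hai (show i ≤ j by omega) (by omega) ?_ fun m hm hmj => ?_
    · simp only [orient, cross]; linarith
    · exact hc m (j + 1) (by omega) (by omega) hkb

end ConvexChain

end Orientation

/-! ### Orbits of a single affine half-map -/

section HalfMap

variable {τ δ : ℝ}

@[simp] theorem halfMap_zero_coord (x : Plane) : halfMap τ δ x 0 = τ * x 0 + x 1 + 1 := by
  simp [halfMap]

@[simp] theorem halfMap_one_coord (x : Plane) : halfMap τ δ x 1 = -δ * x 0 := by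
  simp [halfMap]

theorem halfMap_combo (p q : Plane) {s t : ℝ} (hst : s + t = 1) :
    halfMap τ δ (s • p + t • q) = s • halfMap τ δ p + t • halfMap τ δ q := by
  obtain rfl : s = 1 - t := by linarith
  apply plane_ext <;> simp <;> ring

/-- The right side is `δ * orient p q c`, where `c = (0, -1)` is the preimage of the origin. -/
theorem cross_halfMap (p q : Plane) :
    cross (halfMap τ δ p) (halfMap τ δ q) = δ * (cross p q + p 0 - q 0) := by
  simp [cross]; ring

theorem orient_halfMap (a b c : Plane) :
    orient (halfMap τ δ a) (halfMap τ δ b) (halfMap τ δ c) = δ * orient a b c := by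
  simp [orient, cross]; ring

theorem halfMap_mem_segment {p q x : Plane} (hx : x ∈ segment ℝ p q) :
    halfMap τ δ x ∈ segment ℝ (halfMap τ δ p) (halfMap τ δ q) := by
  obtain ⟨s, t, hs, ht, hst, rfl⟩ := hx
  exact ⟨s, t, hs, ht, hst, (halfMap_combo p q hst).symm⟩

variable {S : ℕ → Plane}

theorem cross_succ_of_halfMap (hS : ∀ i, S (i + 1) = halfMap τ δ (S i)) (i : ℕ) :
    cross (S (i + 1)) (S (i + 2)) =
      δ * (cross (S i) (S (i + 1)) + S i 0 - S (i + 1) 0) := by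
  rw [show S (i + 2) = halfMap τ δ (S (i + 1)) from hS (i + 1)]
  conv_lhs => rw [hS i]
  rw [cross_halfMap, ← hS i]

theorem cross_succ_eq (hS : ∀ i, S (i + 1) = halfMap τ δ (S i)) (i : ℕ) :
    cross (S (i + 1)) (S (i + 2)) = δ * (S i 0 * S (i + 2) 0 - S (i + 1) 0 ^ 2) := by
  have h1 : S (i + 2) 1 = -δ * S (i + 1) 0 := by rw [hS (i + 1)]; simp
  have h2 : S (i + 1) 1 = -δ * S i 0 := by rw [hS i]; simp
  rw [cross, h1, h2]; ring

theorem orient_succ_of_halfMap (hS : ∀ i, S (i + 1) = halfMap τ δ (S i)) (i : ℕ) :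
    orient (S (i + 1)) (S (i + 2)) (S (i + 3)) =
      δ * orient (S i) (S (i + 1)) (S (i + 2)) := by
  rw [← orient_halfMap (τ := τ), ← hS, ← hS, ← hS]

/-- The value is the cross product of a step `(u, v)` of the orbit with the next step `(τ u + v, -δ
u)`. -/
theorem orient_eq_of_halfMap (hS : ∀ i, S (i + 1) = halfMap τ δ (S i)) (i : ℕ) :
    orient (S i) (S (i + 1)) (S (i + 2)) =
      -(δ * (S (i + 1) 0 - S i 0) ^ 2 + τ * (S (i + 1) 0 - S i 0) * (S (i + 1) 1 - S i 1) +
        (S (i + 1) 1 - S i 1) ^ 2) := by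
  rw [hS (i + 1), hS i]; simp [orient, cross]; ring

theorem orient_nonneg_of_halfMap (hδ : 0 < δ) (hS : ∀ i, S (i + 1) = halfMap τ δ (S i)) {i : ℕ}
    (hi : 0 ≤ orient (S i) (S (i + 1)) (S (i + 2))) (j : ℕ) :
    0 ≤ orient (S j) (S (j + 1)) (S (j + 2)) := by
  have h0 : 0 ≤ orient (S 0) (S 1) (S 2) := by
    induction i with
    | zero => exact hi
    | succ i ih =>
      rw [show i + 1 + 1 = i + 2 from rfl, show i + 1 + 2 = i + 3 from rfl,
        orient_succ_of_halfMap hS] at hi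
      exact ih (nonneg_of_mul_nonneg_right hi hδ)
  induction j with
  | zero => exact h0
  | succ j ih =>
    rw [show j + 1 + 1 = j + 2 from rfl, show j + 1 + 2 = j + 3 from rfl,
      orient_succ_of_halfMap hS]
    exact mul_nonneg hδ.le ih

/-- If an orbit of the half-map does not turn clockwise and has a step to the right and down from
the vertical axis, then `τ` is positive. -/
theorem tau_pos_of_orient_nonneg (hδ : 0 < δ) (hS : ∀ i, S (i + 1) = halfMap τ δ (S i)) {N : ℕ}
    (h0 : S N 0 = 0) (h1 : 0 < S N 1) (h : 0 ≤ orient (S N) (S (N + 1)) (S (N + 2))) : 0 < τ := by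
  rw [orient_eq_of_halfMap hS, hS N] at h
  simp only [halfMap_zero_coord, halfMap_one_coord, h0] at h
  have : 0 < δ * (S N 1 + 1) ^ 2 := by positivity
  by_contra hτ
  have : τ * (S N 1 + 1) * S N 1 ≤ 0 :=
    mul_nonpos_of_nonpos_of_nonneg
      (mul_nonpos_of_nonpos_of_nonneg (not_lt.mp hτ) (by linarith)) h1.le
  nlinarith

/-- Without a clockwise turn, `δ u² + τ u v + v² ≤ 0`, which forces `u v < 0`. This keeps the steps
of such an orbit in one open quadrant. -/
theorem mul_neg_of_orient_nonneg (hδ : 0 < δ) (hτ : 0 < τ)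
    (hS : ∀ i, S (i + 1) = halfMap τ δ (S i)) {i : ℕ}
    (h : 0 ≤ orient (S i) (S (i + 1)) (S (i + 2))) (hb : S (i + 1) 1 - S i 1 ≠ 0) :
    (S (i + 1) 0 - S i 0) * (S (i + 1) 1 - S i 1) < 0 := by
  rw [orient_eq_of_halfMap hS] at h
  set u := S (i + 1) 0 - S i 0
  set v := S (i + 1) 1 - S i 1
  have h1 : 0 ≤ δ * u ^ 2 := by positivity
  have h2 : 0 < v ^ 2 := by positivity
  have h3 : τ * (u * v) < 0 := by nlinarith
  exact neg_of_mul_neg_right h3 hτ.le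

section LeftChain

variable {N : ℕ}

/-- Otherwise every step would go left and up, whereas the step from `S N` on the vertical axis goes
right. -/
theorem orient_neg_of_left_chain (hδ : 0 < δ) (hS : ∀ i, S (i + 1) = halfMap τ δ (S i))
    (hN : 0 < N) (hneg : ∀ i < N, S i 0 < 0) (hN0 : S N 0 = 0) (hN1 : 0 < S N 1)
    (h01 : S 0 1 ≤ 0) (i : ℕ) : orient (S i) (S (i + 1)) (S (i + 2)) < 0 := by
  by_contra hc
  have hall := orient_nonneg_of_halfMap hδ hS (not_lt.mp hc)
  have hτ := tau_pos_of_orient_nonneg hδ hS hN0 hN1 (hall N)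
  have hmain : ∀ j, S (j + 1) 0 - S j 0 < 0 ∧ 0 < S (j + 1) 1 - S j 1 := by
    intro j
    induction j with
    | zero =>
      have hb : 0 < S (0 + 1) 1 - S 0 1 := by
        rw [hS 0]; simp only [halfMap_one_coord]
        have := mul_pos_of_neg_of_neg (neg_lt_zero.mpr hδ) (hneg 0 hN)
        linarith
      exact ⟨neg_of_mul_neg_left (mul_neg_of_orient_nonneg hδ hτ hS (hall 0) hb.ne') hb.le, hb⟩
    | succ j ih =>
      have hb : 0 < S (j + 1 + 1) 1 - S (j + 1) 1 := by
        rw [hS (j + 1)]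
        conv_rhs => arg 2; rw [hS j]
        simp only [halfMap_one_coord]
        nlinarith [ih.1]
      exact ⟨neg_of_mul_neg_left
        (mul_neg_of_orient_nonneg hδ hτ hS (hall (j + 1)) hb.ne') hb.le, hb⟩
  have := (hmain N).1
  rw [hS N] at this
  simp only [halfMap_zero_coord, hN0] at this
  linarith

/-- At the first failure the orbit moves left. By `cross_succ_eq` it then keeps moving left and the
failure persists up to index `N`, where the cross product is known to be negative. -/
theorem cross_neg_of_left_chain (hδ : 0 < δ) (hS : ∀ i, S (i + 1) = halfMap τ δ (S i))
    (hN : 0 < N) (hneg : ∀ i < N, S i 0 < 0) (hN0 : S N 0 = 0) (hN1 : 0 < S N 1)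
    (h01 : S 0 1 ≤ 0) {i : ℕ} (hi : i ≤ N) : cross (S i) (S (i + 1)) < 0 := by
  have hlast : cross (S N) (S (N + 1)) < 0 := by
    rw [hS N]; simp only [cross, halfMap_zero_coord, halfMap_one_coord, hN0]
    nlinarith
  have hle : ∀ i ≤ N, S i 0 ≤ 0 := fun i hi => by
    rcases hi.eq_or_lt with rfl | hlt
    · exact hN0.le
    · exact (hneg i hlt).le
  have hfirst : cross (S 0) (S 1) < 0 := by
    have h1 := hle 1 hN
    have h2 := hneg 0 hN
    have h3 : S 1 1 = -δ * S 0 0 := by rw [hS 0]; simp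
    have h4 := mul_nonneg_of_nonpos_of_nonpos h01 h1
    have h5 : 0 < δ * (S 0 0 * S 0 0) := mul_pos hδ (mul_pos_of_neg_of_neg h2 h2)
    rw [cross, h3]; linarith
  by_contra hc
  classical
  have hex : ∃ i, 0 ≤ cross (S i) (S (i + 1)) := ⟨i, not_lt.mp hc⟩
  have hspec := Nat.find_spec hex
  have hmin : ∀ m < Nat.find hex, cross (S m) (S (m + 1)) < 0 :=
    fun m hm => not_le.mp (Nat.find_min hex hm)
  have hkN : Nat.find hex ≤ N := (Nat.find_min' hex (not_lt.mp hc)).trans hi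
  obtain ⟨k, hk⟩ : ∃ k, Nat.find hex = k + 1 := by
    refine ⟨Nat.find hex - 1, ?_⟩
    have : Nat.find hex ≠ 0 := fun h => by
      rw [h] at hspec
      exact hfirst.not_ge hspec
    omega
  rw [hk] at hspec hmin hkN
  have hprev := hmin k (by omega)
  have hmain : ∀ j, k ≤ j → j + 1 ≤ N →
      0 ≤ cross (S (j + 1)) (S (j + 2)) ∧ S (j + 1) 0 < S j 0 := by
    intro j hkj
    induction j, hkj using Nat.le_induction with
    | base =>
      intro _
      refine ⟨hspec, ?_⟩
      rw [cross_succ_of_halfMap hS] at hspec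
      have := nonneg_of_mul_nonneg_right hspec hδ
      linarith
    | succ j hj ih =>
      intro hjN
      obtain ⟨h1, h2⟩ := ih (by omega)
      have h3 := hneg j (by omega)
      have h4 := hneg (j + 1) (by omega)
      have h5 := h1
      rw [cross_succ_eq hS] at h5
      have h6 := nonneg_of_mul_nonneg_right h5 hδ
      have h7 : S (j + 1 + 1) 0 < S (j + 1) 0 := by
        by_contra hcon
        have a := mul_le_mul_of_nonpos_left (not_lt.mp hcon) h3.le
        have b := mul_lt_mul_of_neg_right h2 h4
        have e : S (j + 2) 0 = S (j + 1 + 1) 0 := rfl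
        rw [← e] at a
        nlinarith
      refine ⟨?_, h7⟩
      rw [show j + 1 + 1 = j + 2 from rfl, show j + 1 + 2 = j + 1 + 2 from rfl]
      have := cross_succ_of_halfMap hS (j + 1)
      rw [show j + 1 + 1 = j + 2 from rfl] at this h7
      rw [this]
      exact mul_nonneg hδ.le (by linarith)
  obtain ⟨M, rfl⟩ : ∃ M, N = M + 1 := ⟨N - 1, by omega⟩
  exact hlast.not_ge (hmain M (by omega) le_rfl).1

end LeftChain

section RightChain

variable {r : ℕ}

/-- Otherwise every step would go right and down, so the orbit could not return to the left
half-plane. -/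
theorem orient_neg_of_right_chain (hδ : 0 < δ) (hS : ∀ i, S (i + 1) = halfMap τ δ (S i))
    (h00 : S 0 0 = 0) (h01 : 0 < S 0 1) (hr : S r 0 ≤ 0) (hr0 : 0 < r) (i : ℕ) :
    orient (S i) (S (i + 1)) (S (i + 2)) < 0 := by
  by_contra hc
  have hall := orient_nonneg_of_halfMap hδ hS (not_lt.mp hc)
  have hτ := tau_pos_of_orient_nonneg hδ hS h00 h01 (hall 0)
  have hmain : ∀ j, 0 < S (j + 1) 0 - S j 0 ∧ S (j + 1) 1 - S j 1 < 0 := by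
    intro j
    induction j with
    | zero =>
      rw [hS 0]
      simp only [halfMap_one_coord, halfMap_zero_coord, h00]
      constructor <;> linarith
    | succ j ih =>
      have hb : S (j + 1 + 1) 1 - S (j + 1) 1 < 0 := by
        rw [hS (j + 1)]
        conv_lhs => arg 2; rw [hS j]
        simp only [halfMap_one_coord]
        nlinarith [ih.1]
      exact ⟨pos_of_mul_neg_left
        (mul_neg_of_orient_nonneg hδ hτ hS (hall (j + 1)) hb.ne) hb.le, hb⟩
  have hmono : StrictMono fun j => S j 0 :=
    strictMono_nat_of_lt_succ fun j => by linarith [(hmain j).1]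
  have := hmono hr0
  simp only [h00] at this
  linarith

/-- If the orbit of a point on the positive vertical axis turns counter-clockwise about the origin
while it stays in the right half-plane, then it stays there forever. -/
theorem right_chain_trapped (hδ : 0 < δ) (hS : ∀ i, S (i + 1) = halfMap τ δ (S i))
    (h00 : S 0 0 = 0) (h01 : 0 < S 0 1) {k : ℕ} (hk : 0 < k)
    (hpos : ∀ i, 0 < i → i ≤ k + 1 → 0 < S i 0) (hc : cross (S k) (S (k + 1)) ≤ 0)
    (hc' : 0 < cross (S (k + 1)) (S (k + 2))) (hd : S (k + 1) 0 < S k 0) (i : ℕ) :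
    0 < S (i + 1) 0 := by
  -- The height at which the line through `S k` and `S (k + 1)` meets the vertical axis. The sign of
  -- the next cross product says that it is above the preimage `(0, -1)` of the origin.
  set h : ℝ := -cross (S k) (S (k + 1)) / (S (k + 1) 0 - S k 0) with hh
  have hd' : S (k + 1) 0 - S k 0 < 0 := by linarith
  have hx := hpos k hk (by omega)
  have hx' := hpos (k + 1) (by omega) le_rfl
  have h_nonpos : h ≤ 0 := div_nonpos_of_nonneg_of_nonpos (by linarith) hd'.le
  have h_gt : -1 < h := by
    rw [cross_succ_of_halfMap hS] at hc'
    have := pos_of_mul_pos_right hc' hδ.le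
    rw [hh, lt_div_iff_of_neg hd']
    linarith
  set Y : Plane := !₂[0, h] with hY
  -- The convex hull of `A` is mapped into itself: `0` and `Y` go to the horizontal segment from `0`
  -- to `S 1`, and `S k` goes to a point of the segment from `Y` to `S k`.
  set A : Set Plane := {0, Y} ∪ S '' Iic k with hA
  set D := convexHull ℝ A with hD
  have hAD : A ⊆ D := subset_convexHull ℝ A
  have hSA : ∀ j ≤ k, S j ∈ D := fun j hj => hAD (Or.inr ⟨j, hj, rfl⟩)
  have hYD : Y ∈ D := hAD (Or.inl (Or.inr rfl))
  have h0D : (0 : Plane) ∈ D := hAD (Or.inl (Or.inl rfl))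
  have hconv : Convex ℝ D := convex_convexHull ℝ A
  have haxis : ∀ a : ℝ, 0 ≤ a → a ≤ 1 → ∀ p : Plane, p 0 = a → p 1 = 0 → p ∈ D := by
    intro a ha ha1 p hp0 hp1
    have h1 : S 1 0 = S 0 1 + 1 := by rw [hS 0]; simp [h00]
    have h2 : S 1 1 = 0 := by rw [hS 0]; simp [h00]
    have hp : p = (1 - a / (S 0 1 + 1)) • (0 : Plane) + (a / (S 0 1 + 1)) • S 1 := by
      apply plane_ext
      · simp only [smul_zero, zero_add, PiLp.smul_apply, smul_eq_mul, h1, hp0]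
        rw [div_mul_cancel₀]; linarith
      · simp [h2, hp1]
    rw [hp]
    have hb : a / (S 0 1 + 1) ≤ 1 := by
      rw [div_le_one (by linarith)]; linarith
    exact hconv h0D (hSA 1 hk) (by linarith) (div_nonneg ha (by linarith)) (by ring)
  have hnext : S (k + 1) ∈ D := by
    have : S (k + 1) = (S (k + 1) 0 / S k 0) • S k + (1 - S (k + 1) 0 / S k 0) • Y := by
      have hne : S k 0 ≠ 0 := hx.ne'
      apply plane_ext
      · simp only [hY, PiLp.add_apply, PiLp.smul_apply, smul_eq_mul]
        simp [hne]
      · have hne' : S (k + 1) 0 - S k 0 ≠ 0 := hd'.ne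
        simp only [hY, PiLp.add_apply, PiLp.smul_apply, smul_eq_mul]
        simp only [Matrix.cons_val_one, Matrix.cons_val_fin_one]
        have e : 1 - S (k + 1) 0 / S k 0 = -(S (k + 1) 0 - S k 0) / S k 0 := by
          field_simp; ring
        have e2 : -(S (k + 1) 0 - S k 0) / S k 0 * h = cross (S k) (S (k + 1)) / S k 0 := by
          rw [hh]; field_simp
        rw [e, e2, cross]
        field_simp
        ring
    rw [this]
    exact hconv (hSA k le_rfl) hYD (div_nonneg hx'.le hx.le)
      (sub_nonneg.mpr ((div_le_one hx).mpr hd.le)) (by ring)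
  have hmap : ∀ p ∈ D, halfMap τ δ p ∈ D ∧ 0 < halfMap τ δ p 0 := by
    have hsub : A ⊆ {p | halfMap τ δ p ∈ D ∧ 0 < halfMap τ δ p 0} := by
      rintro p ((rfl | rfl) | ⟨j, hj, rfl⟩)
      · exact ⟨haxis 1 zero_le_one le_rfl _ (by simp) (by simp), by simp⟩
      · exact ⟨haxis (h + 1) (by linarith) (by linarith) _ (by simp [hY]) (by simp [hY]), by
          simp [hY]; linarith⟩
      · have hj' : j ≤ k := hj
        show _ ∧ _
        rw [← hS j]
        refine ⟨?_, hpos (j + 1) (by omega) (by omega)⟩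
        rcases hj'.eq_or_lt with rfl | hlt
        · exact hnext
        · exact hSA (j + 1) hlt
    refine fun p hp => convexHull_min hsub ?_ hp
    rintro p ⟨hp1, hp2⟩ q ⟨hq1, hq2⟩ s t hs ht hst
    show _ ∧ _
    rw [halfMap_combo p q hst]
    refine ⟨hconv hp1 hq1 hs ht hst, ?_⟩
    simp only [PiLp.add_apply, PiLp.smul_apply, smul_eq_mul]
    rcases hs.eq_or_lt with rfl | hs'
    · obtain rfl : t = 1 := by linarith
      simpa using hq2
    · have := mul_pos hs' hp2
      have := mul_nonneg ht hq2.le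
      linarith
  have hmem : ∀ i, S i ∈ D := by
    intro i
    induction i with
    | zero => exact hSA 0 (Nat.zero_le _)
    | succ i ih => rw [hS i]; exact (hmap _ ih).1
  rw [hS i]
  exact (hmap _ (hmem i)).2

theorem cross_neg_of_right_chain (hδ : 0 < δ) (hS : ∀ i, S (i + 1) = halfMap τ δ (S i))
    (h00 : S 0 0 = 0) (h01 : 0 < S 0 1) (hpos : ∀ i, 0 < i → i < r → 0 < S i 0)
    (hr : S r 0 ≤ 0) {i : ℕ} (hi : i < r) : cross (S i) (S (i + 1)) < 0 := by
  have h10 : S 1 0 = S 0 1 + 1 := by rw [hS 0]; simp [h00]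
  have hr2 : 2 ≤ r := by
    by_contra hlt
    obtain rfl : r = 1 := by omega
    linarith
  have hfirst : cross (S 0) (S 1) < 0 := by
    rw [cross, h10, h00]; nlinarith
  have hle : ∀ i < r, cross (S i) (S (i + 1)) ≤ 0 := by
    intro i
    induction i with
    | zero => intro _; exact hfirst.le
    | succ k ih =>
      intro hk
      have h1 := ih (by omega)
      by_contra hcon
      have h2 := not_le.mp hcon
      have h3 := h2
      rw [show k + 1 + 1 = k + 2 from rfl, cross_succ_of_halfMap hS] at h3
      have h4 := pos_of_mul_pos_right h3 hδ.le
      have hk0 : 0 < k := by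
        rcases Nat.eq_zero_or_pos k with rfl | h
        · rw [h00] at h4
          simp only [zero_add] at h4 h1
          linarith
        · exact h
      have := right_chain_trapped hδ hS h00 h01 hk0 (fun j hj hjk => hpos j hj (by omega)) h1 h2
        (by linarith) (r - 1)
      rw [show r - 1 + 1 = r by omega] at this
      linarith
  refine lt_of_le_of_ne (hle i hi) ?_
  -- A vanishing cross product forces the preceding one to vanish, and so on back to the first one,
  -- which is negative. The last index is treated separately, since the step after it is not
  -- controlled.
  have hne : ∀ j, j + 1 < r → cross (S j) (S (j + 1)) ≠ 0 := by
    intro j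
    induction j with
    | zero => intro _; exact hfirst.ne
    | succ j ih =>
      intro hj h0
      have h1 : cross (S (j + 2)) (S (j + 3)) ≤ 0 := hle (j + 2) hj
      have h0' : cross (S (j + 1)) (S (j + 2)) = 0 := h0
      have h1' := cross_succ_of_halfMap hS (j + 1)
      rw [show j + 1 + 1 = j + 2 from rfl, show j + 1 + 2 = j + 3 from rfl, h0'] at h1'
      have h2 : S (j + 1) 0 ≤ S (j + 2) 0 := by
        rw [h1'] at h1
        have := nonpos_of_mul_nonpos_right h1 hδ
        linarith
      have h3 := cross_succ_eq hS j
      rw [h0'] at h3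
      have h4 := (mul_eq_zero.mp h3.symm).resolve_left hδ.ne'
      have h5 := hpos (j + 1) (by omega) (by omega)
      have h6 : S j 0 ≤ S (j + 1) 0 := by
        by_contra hcon
        have h7 := not_le.mp hcon
        nlinarith
      have h8 := cross_succ_of_halfMap hS j
      rw [h0'] at h8
      have h9 := (mul_eq_zero.mp h8.symm).resolve_left hδ.ne'
      exact ih (by omega) (le_antisymm (hle j (by omega)) (by linarith))
  rcases Nat.lt_or_ge (i + 1) r with hlt | hge
  · exact hne i hlt
  · obtain ⟨k, rfl⟩ : ∃ k, i = k + 1 := ⟨i - 1, by omega⟩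
    obtain rfl : r = k + 2 := by omega
    rw [show k + 1 + 1 = k + 2 from rfl, cross_succ_eq hS]
    have h1 := hpos (k + 1) (by omega) (by omega)
    have h2 : 0 ≤ S k 0 := by
      rcases Nat.eq_zero_or_pos k with rfl | h
      · exact h00.ge
      · exact (hpos k h (by omega)).le
    have h3 := mul_nonpos_of_nonneg_of_nonpos h2 hr
    have : S k 0 * S (k + 2) 0 - S (k + 1) 0 ^ 2 < 0 := by nlinarith
    exact (mul_neg_of_pos_of_neg hδ this).ne

end RightChain

end HalfMap

/-! ### Geometry of the orbit polygon -/

/-- The polygon `Q` that consists of the orbit `S` of the left half-map, cut at the point `U` of its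
first edge, and of the orbit `R` of the right half-map, which continues `S` at the vertical axis.
The point `Y` is the intersection of the last edge of `R` with the vertical axis. -/
structure OrbitPolygon (τL δL τR δR : ℝ) (S R Q : ℕ → Plane) (U Y : Plane) (N r : ℕ) : Prop where
  δL_pos : 0 < δL
  δR_pos : 0 < δR
  S_succ : ∀ i, S (i + 1) = halfMap τL δL (S i)
  R_succ : ∀ i, R (i + 1) = halfMap τR δR (R i)
  S_last : S N = R 0
  R_zero0 : R 0 0 = 0
  R_zero1 : 0 < R 0 1
  N_pos : 0 < N
  r_pos : 0 < r
  S_neg : ∀ i < N, S i 0 < 0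
  S_zero1 : S 0 1 ≤ 0
  R_pos : ∀ i, 0 < i → i < r → 0 < R i 0
  R_last : R r 0 ≤ 0
  U1 : U 1 = 0
  U_mem : ∃ c : ℝ, 0 ≤ c ∧ c < 1 ∧ U = (1 - c) • S 0 + c • S 1
  Q_zero : Q 0 = U
  Q_eq_S : ∀ j, 0 < j → j ≤ N + 1 → Q j = S j
  Q_eq_R : ∀ j ≤ r, Q (N + j) = R j
  Q_last : Q (N + 1 + r) = U
  Y_mem : Y ∈ segment ℝ (R (r - 1)) (R r)
  Y0 : Y 0 = 0
  U_lt_Y : U 0 < Y 1 + 1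
  orient_left : orient (S 0) (S 1) (R r) < 0
  orient_image : orient U (S 1) (halfMap τL δL (R r)) < 0

namespace OrbitPolygon

variable {τL δL τR δR : ℝ} {S R Q : ℕ → Plane} {U Y : Plane} {N r : ℕ}

theorem R_one0 (h : OrbitPolygon τL δL τR δR S R Q U Y N r) : R 1 0 = R 0 1 + 1 := by
  rw [h.R_succ 0]; simp [h.R_zero0]

theorem R_one1 (h : OrbitPolygon τL δL τR δR S R Q U Y N r) : R 1 1 = 0 := by
  rw [h.R_succ 0]; simp [h.R_zero0]

theorem S_last_succ (h : OrbitPolygon τL δL τR δR S R Q U Y N r) : S (N + 1) = R 1 := by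
  rw [h.S_succ N, h.S_last]
  apply plane_ext
  · rw [h.R_one0]; simp [h.R_zero0]
  · rw [h.R_one1]; simp [h.R_zero0]

theorem two_le_r (h : OrbitPolygon τL δL τR δR S R Q U Y N r) : 2 ≤ r := by
  have h1 := h.R_one0
  have h2 := h.R_zero1
  have h3 := h.R_last
  by_contra hr
  have h4 := h.r_pos
  obtain rfl : r = 1 := by omega
  linarith

theorem S_nonpos (h : OrbitPolygon τL δL τR δR S R Q U Y N r) {i : ℕ} (hi : i ≤ N) :
    S i 0 ≤ 0 := by
  rcases hi.eq_or_lt with rfl | hlt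
  · rw [h.S_last, h.R_zero0]
  · exact (h.S_neg i hlt).le

theorem S_succ_pos (h : OrbitPolygon τL δL τR δR S R Q U Y N r) {i : ℕ} (hi : i < N) :
    0 < S (i + 1) 1 := by
  rw [h.S_succ i, halfMap_one_coord]
  exact mul_pos_of_neg_of_neg (neg_lt_zero.mpr h.δL_pos) (h.S_neg i hi)

theorem R_nonneg (h : OrbitPolygon τL δL τR δR S R Q U Y N r) {i : ℕ} (hi : i < r) :
    0 ≤ R i 0 := by
  rcases Nat.eq_zero_or_pos i with rfl | h0
  · exact h.R_zero0.ge
  · exact (h.R_pos i h0 hi).le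

theorem R_succ_nonpos (h : OrbitPolygon τL δL τR δR S R Q U Y N r) {i : ℕ} (hi : i < r) :
    R (i + 1) 1 ≤ 0 := by
  rw [h.R_succ i, halfMap_one_coord]
  exact mul_nonpos_of_nonpos_of_nonneg (neg_nonpos.mpr h.δR_pos.le) (h.R_nonneg hi)

theorem R_succ_neg (h : OrbitPolygon τL δL τR δR S R Q U Y N r) {i : ℕ} (h0 : 0 < i)
    (hi : i < r) : R (i + 1) 1 < 0 := by
  rw [h.R_succ i, halfMap_one_coord]
  exact mul_neg_of_neg_of_pos (neg_lt_zero.mpr h.δR_pos) (h.R_pos i h0 hi)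

theorem R_last1 (h : OrbitPolygon τL δL τR δR S R Q U Y N r) : R r 1 < 0 := by
  have := h.two_le_r
  have := h.R_succ_neg (i := r - 1) (by omega) (by omega)
  rwa [show r - 1 + 1 = r by omega] at this

theorem U0 (h : OrbitPolygon τL δL τR δR S R Q U Y N r) : U 0 < 0 := by
  obtain ⟨c, hc0, hc1, e⟩ := h.U_mem
  have h13 : U 0 = (1 - c) * S 0 0 + c * S 1 0 := by rw [e]; simp
  have := mul_neg_of_pos_of_neg (show 0 < 1 - c by linarith) (h.S_neg 0 h.N_pos)
  have := mul_nonpos_of_nonneg_of_nonpos hc0 (h.S_nonpos (i := 1) h.N_pos)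
  linarith

theorem S_cross (h : OrbitPolygon τL δL τR δR S R Q U Y N r) {i : ℕ} (hi : i ≤ N) :
    cross (S i) (S (i + 1)) < 0 :=
  cross_neg_of_left_chain h.δL_pos h.S_succ h.N_pos h.S_neg (by rw [h.S_last, h.R_zero0])
    (by rw [h.S_last]; exact h.R_zero1) h.S_zero1 hi

theorem S_orient (h : OrbitPolygon τL δL τR δR S R Q U Y N r) (i : ℕ) :
    orient (S i) (S (i + 1)) (S (i + 2)) < 0 :=
  orient_neg_of_left_chain h.δL_pos h.S_succ h.N_pos h.S_neg (by rw [h.S_last, h.R_zero0])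
    (by rw [h.S_last]; exact h.R_zero1) h.S_zero1 i

theorem R_cross (h : OrbitPolygon τL δL τR δR S R Q U Y N r) {i : ℕ} (hi : i < r) :
    cross (R i) (R (i + 1)) < 0 :=
  cross_neg_of_right_chain h.δR_pos h.R_succ h.R_zero0 h.R_zero1 h.R_pos h.R_last hi

theorem R_orient (h : OrbitPolygon τL δL τR δR S R Q U Y N r) (i : ℕ) :
    orient (R i) (R (i + 1)) (R (i + 2)) < 0 :=
  orient_neg_of_right_chain h.δR_pos h.R_succ h.R_zero0 h.R_zero1 h.R_last
    (by have := h.two_le_r; omega) i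

theorem Q_one (h : OrbitPolygon τL δL τR δR S R Q U Y N r) : Q 1 = S 1 :=
  h.Q_eq_S 1 one_pos (by omega)

theorem Q_two (h : OrbitPolygon τL δL τR δR S R Q U Y N r) : Q 2 = S 2 :=
  h.Q_eq_S 2 two_pos (by have := h.N_pos; omega)

theorem Q_succ_eq_R (h : OrbitPolygon τL δL τR δR S R Q U Y N r) {j : ℕ} (hj : j < r) :
    Q (N + 1 + j) = R (j + 1) := by
  rw [← h.Q_eq_R (j + 1) hj]; congr 1; omega

/-- The horizontal axis splits the polygon at `U` and at `R 1`, the image of the point `R 0` on the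
vertical axis. So the upper arc has one edge more than the left orbit up to that point. -/
theorem isStar (h : OrbitPolygon τL δL τR δR S R Q U Y N r) : IsStar Q (N + 1) r where
  upper :=
    { left0 := by rw [h.Q_zero]; exact h.U0
      left1 := by rw [h.Q_zero]; exact h.U1
      right0 := by
        rw [h.Q_eq_S _ (by omega) le_rfl, h.S_last_succ, h.R_one0]
        have := h.R_zero1
        linarith
      right1 := by rw [h.Q_eq_S _ (by omega) le_rfl, h.S_last_succ, h.R_one1]
      pos := by
        intro j h0 hj
        obtain ⟨i, rfl⟩ : ∃ i, j = i + 1 := ⟨j - 1, by omega⟩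
        rw [h.Q_eq_S _ h0 hj.le]
        exact h.S_succ_pos (by omega)
      turn := by
        intro j hj
        rcases Nat.eq_zero_or_pos j with rfl | h0
        · rw [h.Q_zero, zero_add, h.Q_one]
          obtain ⟨c, hc0, hc1, e⟩ := h.U_mem
          have : cross U (S 1) = (1 - c) * cross (S 0) (S 1) := by
            rw [e]; simp [cross]; ring
          rw [this]
          exact mul_neg_of_pos_of_neg (by linarith) (h.S_cross (Nat.zero_le _))
        · rw [h.Q_eq_S j h0 hj.le, h.Q_eq_S (j + 1) (by omega) hj]
          exact h.S_cross (by omega) }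
  lower := by
    have hr := h.two_le_r
    have hU := h.U0
    have hlast : ∀ j, j + 1 = r → Q (N + 1 + j) = R r := by
      intro j hj
      rw [h.Q_succ_eq_R (by omega), hj]
    exact
    { left0 := by
        rw [h.Q_succ_eq_R (by omega)]
        have := h.R_one0
        have := h.R_zero1
        simp only [zero_add, PiLp.neg_apply]
        linarith
      left1 := by
        rw [h.Q_succ_eq_R (by omega)]
        simp [h.R_one1]
      right0 := by
        rw [h.Q_last]
        simpa using hU
      right1 := by
        rw [h.Q_last]
        simpa using h.U1
      pos := by
        intro j h0 hj
        rw [h.Q_succ_eq_R hj]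
        simpa using h.R_succ_neg h0 hj
      turn := by
        intro j hj
        have hneg : ∀ p q : Plane, cross (-p) (-q) = cross p q := fun p q => by simp [cross]
        rw [hneg]
        rcases Nat.lt_or_ge (j + 1) r with hlt | hge
        · rw [h.Q_succ_eq_R hj, h.Q_succ_eq_R hlt]
          exact h.R_cross hlt
        · obtain hjr : j + 1 = r := by omega
          rw [hlast j hjr, hjr, h.Q_last, cross, h.U1]
          have := mul_pos_of_neg_of_neg h.R_last1 hU
          linarith }
  closed := by rw [h.Q_last, h.Q_zero]

theorem upperChain (h : OrbitPolygon τL δL τR δR S R Q U Y N r) : ConvexChain Q 0 (N + 1) where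
  star i _ hi := h.isStar.upper.turn i hi
  turn := by
    intro i _ hi
    rcases Nat.eq_zero_or_pos i with rfl | h0
    · rw [h.Q_zero, zero_add, zero_add, h.Q_one, h.Q_two]
      obtain ⟨c, hc0, hc1, e⟩ := h.U_mem
      have : orient U (S 1) (S 2) = (1 - c) * orient (S 0) (S 1) (S 2) := by
        rw [e]; simp [orient, cross]; ring
      rw [this]
      exact mul_neg_of_pos_of_neg (by linarith) (h.S_orient 0)
    · rw [h.Q_eq_S i h0 (by omega), h.Q_eq_S (i + 1) (by omega) (by omega),
        h.Q_eq_S (i + 2) (by omega) (by omega)]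
      exact h.S_orient i

theorem lowerChain (h : OrbitPolygon τL δL τR δR S R Q U Y N r) : ConvexChain R 1 r where
  star _ _ hi := h.R_cross hi
  turn i _ _ := h.R_orient i

theorem upper_vertex (h : OrbitPolygon τL δL τR δR S R Q U Y N r) {i k : ℕ} (hi : i < N + 1)
    (hk : k ≤ N + 1) : orient (Q i) (Q (i + 1)) (Q k) ≤ 0 :=
  h.upperChain.orient_vertex_nonpos (fun _ _ _ hij hj => h.isStar.upper.cross_nonpos hij hj)
    (Nat.zero_le _) hi (Nat.zero_le _) hk

theorem lower_vertex (h : OrbitPolygon τL δL τR δR S R Q U Y N r) {i k : ℕ} (hi0 : 1 ≤ i)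
    (hi : i < r) (hk0 : 1 ≤ k) (hk : k ≤ r) : orient (R i) (R (i + 1)) (R k) ≤ 0 := by
  refine h.lowerChain.orient_vertex_nonpos (fun a b ha hab hb => ?_) hi0 hi hk0 hk
  have := h.isStar.lower.cross_nonpos (i := a - 1) (j := b - 1) (by omega) (by omega)
  rw [h.Q_succ_eq_R (by omega), h.Q_succ_eq_R (by omega), show a - 1 + 1 = a by omega,
    show b - 1 + 1 = b by omega] at this
  simpa [cross] using this

theorem mem_of_upper (h : OrbitPolygon τL δL τR δR S R Q U Y N r) {p : Plane} (hp : 0 ≤ p 1)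
    (H : ∀ i < N + 1, orient (Q i) (Q (i + 1)) p < 0) : p ∈ starInterior Q (N + 1 + r) := by
  obtain ⟨j, hj, s, t, hst⟩ := h.isStar.exists_upper_sector hp
  refine ⟨j, by omega, s, t, hst, ?_⟩
  have h1 := H j hj
  rw [orient_of_inSector hst] at h1
  have := pos_of_mul_neg_right h1 (h.isStar.upper.turn j hj).le
  linarith

theorem Y1_nonpos (h : OrbitPolygon τL δL τR δR S R Q U Y N r) : Y 1 ≤ 0 := by
  obtain ⟨s, t, hs, ht, hst, e⟩ := h.Y_mem
  have hr := h.two_le_r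
  have h1 := h.R_succ_nonpos (i := r - 2) (by omega)
  rw [show r - 2 + 1 = r - 1 by omega] at h1
  have h2 := mul_nonpos_of_nonneg_of_nonpos hs h1
  have h3 := mul_nonpos_of_nonneg_of_nonpos ht h.R_last1.le
  rw [← e]
  simpa using add_nonpos h2 h3

theorem upper_axis (h : OrbitPolygon τL δL τR δR S R Q U Y N r) {p : Plane} (hp1 : p 1 = 0)
    (hU : U 0 < p 0) (hR : p 0 < R 1 0) {i : ℕ} (hi : i < N + 1) :
    orient (Q i) (Q (i + 1)) p < 0 := by
  have hc := h.isStar.upper.turn i hi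
  have hU0 := h.U0
  have hR0 : 0 < R 1 0 := by rw [h.R_one0]; linarith [h.R_zero1]
  rcases le_total (p 0) 0 with h0 | h0
  · have e : p = (p 0 / U 0) • Q 0 := by
      rw [h.Q_zero]
      apply plane_ext
      · simp [hU0.ne]
      · simp [h.U1, hp1]
    rw [e, orient_smul]
    have h1 : p 0 / U 0 < 1 := by rw [div_lt_one_of_neg hU0]; exact hU
    have h2 : 0 ≤ p 0 / U 0 := div_nonneg_of_nonpos h0 hU0.le
    have h3 := mul_nonpos_of_nonneg_of_nonpos h2 (h.upper_vertex hi (Nat.zero_le _))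
    have h4 := mul_neg_of_pos_of_neg (sub_pos.mpr h1) hc
    linarith
  · have e : p = (p 0 / R 1 0) • Q (N + 1) := by
      rw [h.Q_eq_S _ (by omega) le_rfl, h.S_last_succ]
      apply plane_ext
      · simp [hR0.ne']
      · simp [h.R_one1, hp1]
    rw [e, orient_smul]
    have h1 : p 0 / R 1 0 < 1 := by rw [div_lt_one hR0]; exact hR
    have h2 : 0 ≤ p 0 / R 1 0 := div_nonneg h0 hR0.le
    have h3 := mul_nonpos_of_nonneg_of_nonpos h2 (h.upper_vertex hi le_rfl)
    have h4 := mul_neg_of_pos_of_neg (sub_pos.mpr h1) hc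
    linarith

/-- The hypothesis on the first edge propagates along the convex left chain, because `R r` lies in
the lower left quadrant and hence counter-clockwise of the upper left vertices. -/
theorem orient_S_last (h : OrbitPolygon τL δL τR δR S R Q U Y N r) {i : ℕ} (hi : i < N) :
    orient (S i) (S (i + 1)) (R r) < 0 := by
  have hch : ConvexChain S 0 N :=
    ⟨fun _ _ hi => h.S_cross hi.le, fun i _ _ => h.S_orient i⟩
  refine hch.orient_neg_forward le_rfl (Nat.zero_le i) hi h.orient_left fun k hk hki => ?_
  obtain ⟨m, rfl⟩ : ∃ m, k = m + 1 := ⟨k - 1, by omega⟩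
  have h1 := mul_nonneg_of_nonpos_of_nonpos (h.S_nonpos (i := m + 1) (by omega)) h.R_last1.le
  have h2 := mul_nonpos_of_nonneg_of_nonpos (h.S_succ_pos (i := m) (by omega)).le h.R_last
  rw [cross]
  linarith

/-- Beyond the first edge, each upper edge is the image of a left orbit edge, so `orient_S_last` is
carried over by the map. The first edge is the hypothesis `orient_image`. -/
theorem upper_image_last (h : OrbitPolygon τL δL τR δR S R Q U Y N r) {i : ℕ} (hi : i < N + 1) :
    orient (Q i) (Q (i + 1)) (halfMap τL δL (R r)) < 0 := by
  rcases Nat.eq_zero_or_pos i with rfl | h0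
  · rw [h.Q_zero, zero_add, h.Q_one]; exact h.orient_image
  · obtain ⟨j, rfl⟩ : ∃ j, i = j + 1 := ⟨i - 1, by omega⟩
    rw [h.Q_eq_S (j + 1) h0 hi.le, h.Q_eq_S (j + 1 + 1) (by omega) hi, h.S_succ (j + 1),
      h.S_succ j, orient_halfMap, ← h.S_succ j]
    exact mul_neg_of_pos_of_neg h.δL_pos (h.orient_S_last (by omega))

theorem image_U_mem (h : OrbitPolygon τL δL τR δR S R Q U Y N r) :
    halfMap τL δL U ∈ segment ℝ (Q 1) (Q 2) := by
  obtain ⟨c, hc0, hc1, e⟩ := h.U_mem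
  rw [h.Q_one, h.Q_two, h.S_succ 1, h.S_succ 0]
  have : U ∈ segment ℝ (S 0) (S 1) := ⟨1 - c, c, by linarith, hc0, by ring, e.symm⟩
  simpa [← h.S_succ 0] using halfMap_mem_segment (τ := τL) (δ := δL) this

theorem upper_image_U (h : OrbitPolygon τL δL τR δR S R Q U Y N r) {i : ℕ} (hi : i < N + 1) :
    orient (Q i) (Q (i + 1)) (halfMap τL δL U) ≤ 0 := by
  have hN := h.N_pos
  obtain ⟨s, t, hs, ht, hst, e⟩ := h.image_U_mem
  rw [← e, orient_combo _ _ _ _ hst]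
  have h1 := mul_nonpos_of_nonneg_of_nonpos hs (h.upper_vertex hi (k := 1) (by omega))
  have h2 := mul_nonpos_of_nonneg_of_nonpos ht (h.upper_vertex hi (k := 2) (by omega))
  linarith

theorem image_last1 (h : OrbitPolygon τL δL τR δR S R Q U Y N r) :
    0 ≤ halfMap τL δL (R r) 1 := by
  rw [halfMap_one_coord]
  exact mul_nonneg_of_nonpos_of_nonpos (neg_nonpos.mpr h.δL_pos.le) h.R_last

theorem image_Y1 (h : OrbitPolygon τL δL τR δR S R Q U Y N r) (τ δ : ℝ) :
    halfMap τ δ Y 1 = 0 := by simp [h.Y0]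

theorem image_Y0 (h : OrbitPolygon τL δL τR δR S R Q U Y N r) (τ δ : ℝ) :
    halfMap τ δ Y 0 = Y 1 + 1 := by simp [h.Y0]

theorem Y_lt (h : OrbitPolygon τL δL τR δR S R Q U Y N r) : Y 1 + 1 < R 1 0 := by
  have := h.Y1_nonpos
  have := h.R_zero1
  rw [h.R_one0]; linarith

/-- Both end points lie strictly inside all upper edges: the image of `Y` is on the horizontal axis
strictly between `U` and `R 1`. -/
theorem segment_image_Y_subset (h : OrbitPolygon τL δL τR δR S R Q U Y N r) :
    segment ℝ (halfMap τL δL Y) (halfMap τL δL (R r)) ⊆ starInterior Q (N + 1 + r) := by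
  rintro p ⟨s, t, hs, ht, hst, rfl⟩
  apply h.mem_of_upper
  · have := mul_nonneg ht h.image_last1
    simpa only [PiLp.add_apply, PiLp.smul_apply, smul_eq_mul, h.image_Y1, mul_zero, zero_add]
  · intro i hi
    rw [orient_combo _ _ _ _ hst]
    have h1 := h.upper_axis (h.image_Y1 τL δL) (by rw [h.image_Y0]; exact h.U_lt_Y)
      (by rw [h.image_Y0]; exact h.Y_lt) hi
    have h2 := h.upper_image_last hi
    rcases hs.eq_or_lt with rfl | hs'
    · obtain rfl : t = 1 := by linarith
      linarith
    · have := mul_neg_of_pos_of_neg hs' h1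
      have := mul_nonpos_of_nonneg_of_nonpos ht h2.le
      linarith

theorem image_last_mem (h : OrbitPolygon τL δL τR δR S R Q U Y N r) :
    halfMap τL δL (R r) ∈ starInterior Q (N + 1 + r) :=
  h.segment_image_Y_subset (right_mem_segment _ _ _)

theorem segment_image_U_subset (h : OrbitPolygon τL δL τR δR S R Q U Y N r) {p : Plane}
    (hp : p ∈ segment ℝ (halfMap τL δL (R r)) (halfMap τL δL U)) (hne : p ≠ halfMap τL δL U) :
    p ∈ starInterior Q (N + 1 + r) := by
  obtain ⟨s, t, hs, ht, hst, rfl⟩ := hp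
  have hs' : 0 < s := by
    rcases hs.eq_or_lt with rfl | hs'
    · obtain rfl : t = 1 := by linarith
      simp at hne
    · exact hs'
  apply h.mem_of_upper
  · have h1 := mul_nonneg hs h.image_last1
    have h2 : 0 ≤ halfMap τL δL U 1 := by
      rw [halfMap_one_coord]
      exact mul_nonneg_of_nonpos_of_nonpos (neg_nonpos.mpr h.δL_pos.le) h.U0.le
    simpa only [PiLp.add_apply, PiLp.smul_apply, smul_eq_mul] using add_nonneg h1 (mul_nonneg ht h2)
  · intro i hi
    rw [orient_combo _ _ _ _ hst]
    have := mul_neg_of_pos_of_neg hs' (h.upper_image_last hi)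
    have := mul_nonpos_of_nonneg_of_nonpos ht (h.upper_image_U hi)
    linarith

theorem segment_last_subset (h : OrbitPolygon τL δL τR δR S R Q U Y N r) {p : Plane}
    (hp : p ∈ segment ℝ (R r) (halfMap τR δR Y)) (hne : p ≠ R r) :
    p ∈ starInterior Q (N + 1 + r) := by
  have hr := h.two_le_r
  have hU := h.U0
  have hR0 : 0 < R 1 0 := by rw [h.R_one0]; linarith [h.R_zero1]
  have hQr : Q (N + 1 + (r - 1)) = R r := by
    rw [h.Q_succ_eq_R (by omega), show r - 1 + 1 = r by omega]
  have hQr' : Q (N + 1 + (r - 1) + 1) = U := by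
    rw [show N + 1 + (r - 1) + 1 = N + 1 + r by omega, h.Q_last]
  obtain ⟨s, t, hs, ht, hst, rfl⟩ := hp
  have ht' : 0 < t := by
    rcases ht.eq_or_lt with rfl | ht'
    · obtain rfl : s = 1 := by linarith
      simp at hne
    · exact ht'
  set W := halfMap τR δR Y with hW
  have hW0 : W 0 = Y 1 + 1 := h.image_Y0 _ _
  have hW1 : W 1 = 0 := h.image_Y1 _ _
  -- If `W` is left of the origin, the segment lies in the sector of the closing edge. Otherwise `W`
  -- is a multiple of `R 1`, and convexity of the lower chain applies.
  rcases le_total (W 0) 0 with h0 | h0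
  · have e : W = (W 0 / U 0) • U := by
      apply plane_ext
      · simp [hU.ne]
      · simp [h.U1, hW1]
    have h1 : W 0 / U 0 < 1 := by
      rw [div_lt_one_of_neg hU, hW0]; exact h.U_lt_Y
    have h2 : 0 ≤ W 0 / U 0 := div_nonneg_of_nonpos h0 hU.le
    refine ⟨N + 1 + (r - 1), by omega, s, t * (W 0 / U 0), ⟨hs, mul_nonneg ht h2, ?_⟩, ?_⟩
    · rw [hQr, hQr', mul_smul, ← e]
    · nlinarith
  · have hp1 : (s • R r + t • W) 1 ≤ 0 := by
      have := mul_nonpos_of_nonneg_of_nonpos hs h.R_last1.le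
      simpa [hW1] using this
    obtain ⟨j, hj1, hj2, s', t', H⟩ := h.isStar.exists_lower_sector hp1
    refine ⟨j, hj2, s', t', H, ?_⟩
    suffices hs : orient (Q j) (Q (j + 1)) (s • R r + t • W) < 0 by
      rw [orient_of_inSector H] at hs
      have := pos_of_mul_neg_right hs (h.isStar.turn hj2).le
      linarith
    rw [orient_combo _ _ _ _ hst]
    obtain ⟨k, rfl⟩ := Nat.exists_eq_add_of_le hj1
    rcases Nat.lt_or_ge (k + 1) r with hk | hk
    · rw [add_assoc (N + 1) k 1, h.Q_succ_eq_R (by omega), h.Q_succ_eq_R hk]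
      have e : W = (W 0 / R 1 0) • R 1 := by
        apply plane_ext
        · simp [hR0.ne']
        · simp [h.R_one1, hW1]
      have h1 : W 0 / R 1 0 < 1 := by rw [div_lt_one hR0, hW0]; exact h.Y_lt
      have h2 : 0 ≤ W 0 / R 1 0 := div_nonneg h0 hR0.le
      have h3 : orient (R (k + 1)) (R (k + 1 + 1)) W < 0 := by
        rw [e, orient_smul]
        have a := mul_nonpos_of_nonneg_of_nonpos h2
          (h.lower_vertex (i := k + 1) (k := 1) (by omega) hk le_rfl (by omega))
        have b := mul_neg_of_pos_of_neg (sub_pos.mpr h1) (h.R_cross hk)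
        linarith
      have h4 := mul_nonpos_of_nonneg_of_nonpos hs
        (h.lower_vertex (i := k + 1) (k := r) (by omega) hk (by omega) le_rfl)
      have h5 := mul_neg_of_pos_of_neg ht' h3
      linarith
    · obtain rfl : k = r - 1 := by omega
      rw [hQr, hQr']
      have h1 : orient (R r) U (R r) = 0 := by simp only [orient, cross]; ring
      have h2 : orient (R r) U W = R r 1 * (W 0 - U 0) := by
        simp only [orient, cross, h.U1, hW1]; ring
      rw [h1, h2]
      have h3 := mul_neg_of_neg_of_pos h.R_last1
        (show 0 < W 0 - U 0 by rw [hW0]; linarith [h.U_lt_Y])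
      have := mul_neg_of_pos_of_neg ht' h3
      linarith

/-! ### Images of the edges, forward invariance and entry into the interior -/

section Dynamics

variable {e : Plane ≃ₜ Plane}

theorem coord_nonpos_of_mem_segment {p a b : Plane} (hp : p ∈ segment ℝ a b) (ha : a 0 ≤ 0)
    (hb : b 0 ≤ 0) : p 0 ≤ 0 := by
  obtain ⟨s, t, hs, ht, -, rfl⟩ := hp
  simpa using add_nonpos (mul_nonpos_of_nonneg_of_nonpos hs ha)
    (mul_nonpos_of_nonneg_of_nonpos ht hb)

theorem coord_nonneg_of_mem_segment {p a b : Plane} (hp : p ∈ segment ℝ a b) (ha : 0 ≤ a 0)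
    (hb : 0 ≤ b 0) : 0 ≤ p 0 := by
  obtain ⟨s, t, hs, ht, -, rfl⟩ := hp
  simpa using add_nonneg (mul_nonneg hs ha) (mul_nonneg ht hb)

/-- These edges lie in one half-plane, so their images are segments. The first edge is cut at `U`
and covers only part of the next edge. -/
theorem edge_image (h : OrbitPolygon τL δL τR δR S R Q U Y N r)
    (heL : ∀ p : Plane, p 0 ≤ 0 → e p = halfMap τL δL p)
    (heR : ∀ p : Plane, 0 ≤ p 0 → e p = halfMap τR δR p) {j : ℕ} (hj : j + 1 < N + r)
    {p : Plane} (hp : p ∈ segment ℝ (Q j) (Q (j + 1))) :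
    e p ∈ segment ℝ (Q (j + 1)) (Q (j + 2)) := by
  have hN := h.N_pos
  rcases Nat.eq_zero_or_pos j with rfl | h0
  · rw [h.Q_zero, zero_add, h.Q_one] at hp
    rw [heL p (coord_nonpos_of_mem_segment hp h.U0.le (h.S_nonpos hN))]
    have h1 := halfMap_mem_segment (τ := τL) (δ := δL) hp
    refine (convex_segment (Q 1) (Q 2)).segment_subset h.image_U_mem ?_ h1
    rw [← h.S_succ 1, ← h.Q_two]
    exact right_mem_segment _ _ _
  rcases Nat.lt_or_ge j N with hjN | hjN
  · rw [h.Q_eq_S j h0 (by omega), h.Q_eq_S (j + 1) (by omega) (by omega)] at hp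
    rw [heL p (coord_nonpos_of_mem_segment hp (h.S_nonpos hjN.le) (h.S_nonpos hjN)),
      h.Q_eq_S (j + 1) (by omega) (by omega), h.Q_eq_S (j + 2) (by omega) (by omega),
      h.S_succ (j + 1)]
    have := halfMap_mem_segment (τ := τL) (δ := δL) hp
    rwa [← h.S_succ j] at this
  · obtain ⟨k, rfl⟩ := Nat.exists_eq_add_of_le hjN
    rw [h.Q_eq_R k (by omega), add_assoc, h.Q_eq_R (k + 1) (by omega)] at hp
    rw [heR p (coord_nonneg_of_mem_segment hp (h.R_nonneg (by omega)) (h.R_nonneg (by omega))),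
      add_assoc, add_assoc, h.Q_eq_R (k + 1) (by omega), h.Q_eq_R (k + 2) (by omega),
      h.R_succ (k + 1)]
    have := halfMap_mem_segment (τ := τR) (δ := δR) hp
    rwa [← h.R_succ k] at this

theorem crossing_edge_split (h : OrbitPolygon τL δL τR δR S R Q U Y N r) {p : Plane}
    (hp : p ∈ segment ℝ (R (r - 1)) (R r)) :
    p ∈ segment ℝ (R (r - 1)) Y ∨ p ∈ segment ℝ Y (R r) := by
  obtain ⟨s, t, hs, ht, hst, rfl⟩ := hp
  obtain ⟨a, b, ha, hb, hab, rfl⟩ := h.Y_mem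
  rcases le_or_gt a s with has | has
  · left
    rcases hb.eq_or_lt with rfl | hb'
    · obtain rfl : t = 0 := by linarith
      obtain rfl : s = 1 := by linarith
      simpa using left_mem_segment ℝ (R (r - 1)) _
    · refine ⟨1 - t / b, t / b, sub_nonneg.mpr ?_, div_nonneg ht hb, by ring, ?_⟩
      · rw [div_le_one hb']; linarith
      · rw [smul_add, smul_smul, smul_smul, ← add_assoc, ← add_smul, div_mul_cancel₀ _ hb'.ne']
        congr 2
        obtain rfl : a = 1 - b := by linarith
        obtain rfl : s = 1 - t := by linarith
        field_simp
        ring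
  · right
    have ha' : 0 < a := by linarith
    refine ⟨s / a, 1 - s / a, div_nonneg hs ha, sub_nonneg.mpr ?_, by ring, ?_⟩
    · rw [div_le_one ha']; exact has.le
    · rw [smul_add, smul_smul, smul_smul, add_assoc, ← add_smul, div_mul_cancel₀ _ ha'.ne']
      congr 2
      obtain rfl : b = 1 - a := by linarith
      obtain rfl : t = 1 - s := by linarith
      field_simp
      ring

theorem crossing_edge_image (h : OrbitPolygon τL δL τR δR S R Q U Y N r)
    (heL : ∀ p : Plane, p 0 ≤ 0 → e p = halfMap τL δL p)
    (heR : ∀ p : Plane, 0 ≤ p 0 → e p = halfMap τR δR p) {p : Plane}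
    (hp : p ∈ segment ℝ (R (r - 1)) (R r)) :
    e p = R r ∨ e p ∈ starInterior Q (N + 1 + r) := by
  have hr := h.two_le_r
  rcases h.crossing_edge_split hp with h1 | h1
  · rw [heR p (coord_nonneg_of_mem_segment h1 (h.R_nonneg (by omega)) h.Y0.ge)]
    have h2 := halfMap_mem_segment (τ := τR) (δ := δR) h1
    rw [← h.R_succ, show r - 1 + 1 = r by omega] at h2
    exact or_iff_not_imp_left.mpr fun hne => h.segment_last_subset h2 hne
  · rw [heL p (coord_nonpos_of_mem_segment h1 h.Y0.le h.R_last)]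
    exact Or.inr (h.segment_image_Y_subset (halfMap_mem_segment h1))

theorem closing_edge_image (h : OrbitPolygon τL δL τR δR S R Q U Y N r)
    (heL : ∀ p : Plane, p 0 ≤ 0 → e p = halfMap τL δL p) {p : Plane}
    (hp : p ∈ segment ℝ (R r) U) :
    e p ∈ segment ℝ (Q 1) (Q 2) ∨ e p ∈ starInterior Q (N + 1 + r) := by
  rw [heL p (coord_nonpos_of_mem_segment hp h.R_last h.U0.le)]
  by_cases hne : halfMap τL δL p = halfMap τL δL U
  · rw [hne]; exact Or.inl h.image_U_mem
  · exact Or.inr (h.segment_image_U_subset (halfMap_mem_segment hp) hne)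

theorem segment_subset_starHull {Q : ℕ → Plane} {n j : ℕ} (hj : j < n) :
    segment ℝ (Q j) (Q (j + 1)) ⊆ starHull Q n := by
  intro p hp
  obtain ⟨s, t, H, hst⟩ := mem_segment_iff_inSector.mp hp
  exact ⟨j, hj, s, t, H, hst.le⟩

theorem edge_cases (h : OrbitPolygon τL δL τR δR S R Q U Y N r) {j : ℕ} (hj : j < N + 1 + r)
    {p : Plane} (hp : p ∈ segment ℝ (Q j) (Q (j + 1))) :
    j + 1 < N + r ∨ (j + 1 = N + r ∧ p ∈ segment ℝ (R (r - 1)) (R r)) ∨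
      p ∈ segment ℝ (R r) U := by
  have hr := h.two_le_r
  rcases lt_trichotomy (j + 1) (N + r) with hlt | heq | hgt
  · exact Or.inl hlt
  · refine Or.inr (Or.inl ⟨heq, ?_⟩)
    rw [heq, show j = N + (r - 1) by omega, h.Q_eq_R _ (by omega), h.Q_eq_R r le_rfl] at hp
    exact hp
  · refine Or.inr (Or.inr ?_)
    rw [show j + 1 = N + 1 + r by omega, show j = N + r by omega, h.Q_last,
      h.Q_eq_R r le_rfl] at hp
    exact hp

theorem forward_invariant (h : OrbitPolygon τL δL τR δR S R Q U Y N r)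
    (heL : ∀ p : Plane, p 0 ≤ 0 → e p = halfMap τL δL p)
    (heR : ∀ p : Plane, 0 ≤ p 0 → e p = halfMap τR δR p) :
    e '' starHull Q (N + 1 + r) ⊆ starHull Q (N + 1 + r) := by
  have hN := h.N_pos
  refine h.isStar.image_subset e fun j hj p hp => ?_
  rcases h.edge_cases hj hp with h1 | ⟨-, h1⟩ | h1
  · exact segment_subset_starHull (by omega) (h.edge_image heL heR h1 hp)
  · rcases h.crossing_edge_image heL heR h1 with h2 | h2
    · rw [h2, ← h.Q_eq_R r le_rfl]
      exact segment_subset_starHull (by omega) (left_mem_segment _ _ _)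
    · exact starInterior_subset_starHull _ _ h2
  · rcases h.closing_edge_image heL h1 with h2 | h2
    · exact segment_subset_starHull (by omega) h2
    · exact starInterior_subset_starHull _ _ h2

/-- Boundary points advance one edge per step until the crossing edge. From there two steps suffice:
the first may end at the vertex `R r`, whose image is interior. -/
theorem iterate_mem_interior (h : OrbitPolygon τL δL τR δR S R Q U Y N r)
    (heL : ∀ p : Plane, p 0 ≤ 0 → e p = halfMap τL δL p)
    (heR : ∀ p : Plane, 0 ≤ p 0 → e p = halfMap τR δR p) :
    ∀ p ∈ starHull Q (N + 1 + r), e^[N + 1 + r] p ∈ interior (starHull Q (N + 1 + r)) := by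
  have hN := h.N_pos
  have hr := h.two_le_r
  set I := interior (starHull Q (N + 1 + r)) with hI
  have hWI : starInterior Q (N + 1 + r) ⊆ I := h.isStar.starInterior_subset_interior
  have hstep : ∀ p ∈ I, e p ∈ I := by
    intro p hp
    have : e p ∈ e '' I := ⟨p, hp, rfl⟩
    rw [hI, e.image_interior] at this
    exact interior_mono (h.forward_invariant heL heR) this
  have hit : ∀ k, ∀ p ∈ I, e^[k] p ∈ I := by
    intro k
    induction k with
    | zero => exact fun p hp => hp
    | succ k ih => exact fun p hp => ih _ (hstep p hp)
  have hmono : ∀ {p : Plane} {k m : ℕ}, k ≤ m → e^[k] p ∈ I → e^[m] p ∈ I := by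
    intro p k m hkm hp
    obtain ⟨d, rfl⟩ := Nat.exists_eq_add_of_le hkm
    rw [add_comm, Function.iterate_add_apply]
    exact hit d _ hp
  have hedge : ∀ k j, j + 1 + k = N + r → ∀ p ∈ segment ℝ (Q j) (Q (j + 1)), e^[k + 2] p ∈ I := by
    intro k
    induction k with
    | zero =>
      intro j hj p hp
      rcases h.edge_cases (j := j) (by omega) hp with h1 | ⟨-, h1⟩ | h1
      · omega
      · show e (e p) ∈ I
        rcases h.crossing_edge_image heL heR h1 with h2 | h2
        · rw [h2, heL _ h.R_last]; exact hWI h.image_last_mem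
        · exact hstep _ (hWI h2)
      · show e (e p) ∈ I
        rw [show j = N + (r - 1) by omega, show N + (r - 1) + 1 = N + r by omega,
          h.Q_eq_R _ (by omega), h.Q_eq_R r le_rfl] at hp
        rcases h.crossing_edge_image heL heR hp with h2 | h2
        · rw [h2, heL _ h.R_last]; exact hWI h.image_last_mem
        · exact hstep _ (hWI h2)
    | succ k ih =>
      intro j hj p hp
      exact ih (j + 1) (by omega) (e p) (h.edge_image heL heR (by omega) hp)
  rintro p ⟨j, hj, s, t, H, hst⟩
  rcases hst.lt_or_eq with hlt | heq
  · exact hit _ p (hWI ⟨j, hj, s, t, H, hlt⟩)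
  have hp := mem_segment_iff_inSector.mpr ⟨s, t, H, heq⟩
  rcases Nat.lt_or_ge (N + r) (j + 1) with hjr | hjr
  · have h1 : p ∈ segment ℝ (R r) U := by
      rcases h.edge_cases hj hp with h1 | ⟨h1, -⟩ | h1
      · omega
      · omega
      · exact h1
    rcases h.closing_edge_image heL h1 with h2 | h2
    -- The worst case of the closing edge: one step to edge `1`, then `N + r` more. Starting on edge
    -- `0` takes equally long, whence the exponent `N + 1 + r`.
    · have h3 := hedge (N + r - 2) 1 (by omega) (e p) h2
      rw [← Function.iterate_succ_apply] at h3
      exact hmono (by omega) h3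
    · exact hmono (k := 1) (by omega) (hWI h2)
  · exact hmono (by omega) (hedge (N + r - (j + 1)) j (by omega) p hp)

end Dynamics

end OrbitPolygon

/-! ### The normal form as a homeomorphism, and the final assembly -/

theorem continuous_halfMap (τ δ : ℝ) : Continuous (halfMap τ δ) := by
  unfold halfMap; fun_prop

theorem continuous_halfMapInv (τ δ : ℝ) : Continuous (halfMapInv τ δ) := by
  unfold halfMapInv; fun_prop

theorem bcnf_of_nonpos {τL δL τR δR : ℝ} {p : Plane} (hp : p 0 ≤ 0) :
    bcnf τL δL τR δR p = halfMap τL δL p := if_pos hp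

theorem bcnf_of_nonneg {τL δL τR δR : ℝ} {p : Plane} (hp : 0 ≤ p 0) :
    bcnf τL δL τR δR p = halfMap τR δR p := by
  rcases hp.eq_or_lt with h0 | h0
  · rw [bcnf_of_nonpos h0.ge]
    apply plane_ext <;> simp [← h0]
  · exact if_neg h0.not_ge

theorem continuous_bcnf (τL δL τR δR : ℝ) : Continuous (bcnf τL δL τR δR) := by
  refine Continuous.if_le (continuous_halfMap _ _) (continuous_halfMap _ _) (by fun_prop)
    continuous_const fun p hp => ?_
  apply plane_ext <;> simp [hp]

theorem continuous_bcnfInv (τL δL τR δR : ℝ) : Continuous (bcnfInv τL δL τR δR) := by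
  refine Continuous.if_le (continuous_halfMapInv _ _) (continuous_halfMapInv _ _) continuous_const
    (by fun_prop) fun p hp => ?_
  apply plane_ext <;> simp [halfMapInv, ← hp]

/-- The border-collision normal form as a homeomorphism of the plane. -/
noncomputable def bcnfHomeomorph (τL τR : ℝ) {δL δR : ℝ} (hL : 0 < δL) (hR : 0 < δR) :
    Plane ≃ₜ Plane where
  toFun := bcnf τL δL τR δR
  invFun := bcnfInv τL δL τR δR
  left_inv := bcnfInv_bcnf τL τR hL hR
  right_inv := bcnf_bcnfInv τL τR hL hR
  continuous_toFun := continuous_bcnf _ _ _ _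
  continuous_invFun := continuous_bcnfInv _ _ _ _

theorem exists_coord_eq_of_mem_line {a b p : Plane} (hp : p ∈ line[ℝ, a, b]) :
    ∃ c : ℝ, ∀ i, p i = a i + c * (b i - a i) := by
  obtain ⟨c, rfl⟩ := mem_affineSpan_pair_iff_exists_lineMap_eq.mp hp
  exact ⟨c, fun i => by simp [AffineMap.lineMap_apply]; ring⟩

theorem eq_smul_add_smul_of_coord {a b p : Plane} {c : ℝ}
    (h : ∀ i, p i = a i + c * (b i - a i)) : p = (1 - c) • a + c • b := by
  ext i
  rw [h i]; simp; ring

/-- A point on the right of an upward line makes a clockwise triangle with it. -/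
theorem orient_neg_of_liesRightOfLine {a b p : Plane} (hab : a 1 < b 1)
    (h : LiesRightOfLine p line[ℝ, a, b]) : orient a b p < 0 := by
  obtain ⟨q, hq, h1, h0⟩ := h
  obtain ⟨c, hc⟩ := exists_coord_eq_of_mem_line hq
  have e0 := hc 0
  have e1 := hc 1
  have key : orient a b p = (b 1 - a 1) * (q 0 - p 0) := by
    rw [e0]
    rw [h1] at e1
    simp only [orient, cross, e1]; ring
  rw [key]
  exact mul_neg_of_pos_of_neg (by linarith) (by linarith)

/-- A point above a leftward line makes a clockwise triangle with it. -/
theorem orient_neg_of_liesAboveLine {a b p : Plane} (hab : b 0 < a 0)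
    (h : LiesAboveLine p line[ℝ, a, b]) : orient a b p < 0 := by
  obtain ⟨q, hq, h0, h1⟩ := h
  obtain ⟨c, hc⟩ := exists_coord_eq_of_mem_line hq
  have e0 := hc 0
  have e1 := hc 1
  have key : orient a b p = (b 0 - a 0) * (p 1 - q 1) := by
    rw [e1]
    rw [h0] at e0
    simp only [orient, cross, e0]; ring
  rw [key]
  exact mul_neg_of_neg_of_pos (by linarith) (by linarith)

/-- The existence of `r` and `l` is expressed by taking `r` and `l` to be the least elements of
the sets of admissible indices. The extended Hausdorff distance is infinite when exactly one of
the sets is empty, so the trapping region in the conclusion is nonempty. -/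
theorem proposition6p5
    (τL δL τR δR : ℝ) (hδL : 0 < δL) (hδR : 0 < δR)
    (f g : Plane → Plane) (hf : f = bcnf τL δL τR δR) (hg : g = bcnfInv τL δL τR δR)
    (β : ℝ) (hβ : 0 < β)
    (X : Plane) (hX : X = !₂[0, β])
    (r l : ℕ)
    (hr : IsLeast {i : ℕ | 1 ≤ i ∧ f^[i] X ∈ leftHalfPlane} r)
    (hl : IsLeast {j : ℕ | 1 ≤ j ∧ g^[j] X ∈ rightHalfPlane} l)
    (Z Y V U : Plane)
    (hZ : Z = f^[r] X)
    (hY : Y ∈ (line[ℝ, Z, g Z] : Set Plane) ∩ switchingManifold)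
    (hV : V = g^[l - 1] X)
    (hU : U ∈ (line[ℝ, V, f V] : Set Plane) ∩ f '' switchingManifold)
    (hYass : LiesAbovePoint Y (g U))
    (hZass1 : LiesAboveLine Z line[ℝ, g U, V])
    (hZass2 : LiesRightOfLine Z line[ℝ, V, f V]) :
    ForwardInvariant f (omegaPolygon f g X U l r) ∧
      ∀ ε : ℝ, 0 < ε →
        ∃ T : Set Plane, IsTrappingRegion f T ∧ T ⊆ omegaPolygon f g X U l r ∧
          Metric.hausdorffEDist (omegaPolygon f g X U l r) T ≤ ENNReal.ofReal ε := by
  have hgf : ∀ p, g (f p) = p := by rw [hf, hg]; exact bcnfInv_bcnf τL τR hδL hδR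
  have hfg : ∀ p, f (g p) = p := by rw [hf, hg]; exact bcnf_bcnfInv τL τR hδL hδR
  have hfL : ∀ p : Plane, p 0 ≤ 0 → f p = halfMap τL δL p := fun p hp => by
    rw [hf]; exact bcnf_of_nonpos hp
  have hfR : ∀ p : Plane, 0 ≤ p 0 → f p = halfMap τR δR p := fun p hp => by
    rw [hf]; exact bcnf_of_nonneg hp
  have hgL : ∀ p : Plane, 0 ≤ p 1 → g p = halfMapInv τL δL p := fun p hp => by
    rw [hg]; exact if_pos hp
  have hX0 : X 0 = 0 := by rw [hX]; simp
  have hX1 : X 1 = β := by rw [hX]; simp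
  obtain ⟨⟨hr1, hrZ⟩, hrmin⟩ := hr
  obtain ⟨⟨hl1, hlV⟩, hlmin⟩ := hl
  have hfpos : ∀ i, 0 < i → i < r → 0 < (f^[i] X) 0 := fun i h0 hi => by
    by_contra hc
    exact absurd (hrmin ⟨h0, not_lt.mp hc⟩) (by omega)
  have hgneg : ∀ j, 0 < j → j < l → (g^[j] X) 0 < 0 := fun j h0 hj => by
    by_contra hc
    exact absurd (hlmin ⟨h0, not_lt.mp hc⟩) (by omega)
  obtain ⟨N, rfl⟩ : ∃ N, l = N + 1 := ⟨l - 1, by omega⟩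
  have hN : 0 < N := by
    rcases Nat.eq_zero_or_pos N with rfl | h0
    · have h1 : 0 ≤ (g X) 0 := hlV
      rw [hgL X (by rw [hX1]; exact hβ.le)] at h1
      have : -β / δL < 0 := div_neg_of_neg_of_pos (by linarith) hδL
      rw [← hX1] at this
      exact absurd h1 this.not_ge
    · exact h0
  rw [Nat.add_sub_cancel] at hV
  set S : ℕ → Plane := fun i => (halfMap τL δL)^[i] V
  set R : ℕ → Plane := fun i => (halfMap τR δR)^[i] X
  have hSs : ∀ i, S (i + 1) = halfMap τL δL (S i) := fun i => Function.iterate_succ_apply' _ _ _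
  have hRs : ∀ i, R (i + 1) = halfMap τR δR (R i) := fun i => Function.iterate_succ_apply' _ _ _
  have hS : ∀ i ≤ N, S i = g^[N - i] X := by
    intro i
    induction i with
    | zero => exact fun _ => hV
    | succ i ih =>
      intro hi
      have h1 := ih (by omega)
      have h2 : S i 0 < 0 := by rw [h1]; exact hgneg _ (by omega) (by omega)
      rw [hSs, ← hfL _ h2.le, h1, show N - i = N - (i + 1) + 1 by omega,
        Function.iterate_succ_apply', hfg]
  have hR : ∀ i ≤ r, R i = f^[i] X := by
    intro i
    induction i with
    | zero => exact fun _ => rfl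
    | succ i ih =>
      intro hi
      have h1 := ih (by omega)
      have h2 : 0 ≤ R i 0 := by
        rcases Nat.eq_zero_or_pos i with rfl | h0
        · exact hX0.ge
        · rw [h1]; exact (hfpos i h0 (by omega)).le
      rw [hRs, ← hfR _ h2, h1, Function.iterate_succ_apply']
  have hSneg : ∀ i < N, S i 0 < 0 := fun i hi => by
    rw [hS i hi.le]; exact hgneg _ (by omega) (by omega)
  have hSN : S N = X := by rw [hS N le_rfl]; simp
  have hV0 : V 0 < 0 := hSneg 0 hN
  have hfV : f V = S 1 := by rw [hfL V hV0.le]; rfl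
  have hS1 : 0 < S 1 1 := by
    rw [hSs 0, halfMap_one_coord]
    exact mul_pos_of_neg_of_neg (neg_lt_zero.mpr hδL) hV0
  -- If `V` were above the horizontal axis, its preimage would lie strictly to the left of the
  -- vertical axis, contrary to the choice of `l`.
  have hV1 : V 1 ≤ 0 := by
    by_contra hc
    have h1 : 0 ≤ (g^[N + 1] X) 0 := hlV
    rw [Function.iterate_succ_apply', ← hV, hgL V (not_le.mp hc).le] at h1
    have h2 : -V 1 / δL < 0 := div_neg_of_neg_of_pos (by linarith) hδL
    exact h1.not_gt h2
  have hZR : Z = R r := by rw [hZ, hR r le_rfl]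
  have hZ0 : Z 0 ≤ 0 := by rw [hZ]; exact hrZ
  have hU1 : U 1 = 0 := by
    obtain ⟨q, hq, rfl⟩ := hU.2
    have hq0 : q 0 = 0 := hq
    rw [hfL q hq0.le]; simp [hq0]
  have hgU0 : (g U) 0 = 0 := by rw [hgL U hU1.ge]; simp [halfMapInv, hU1]
  have hgU1 : (g U) 1 = U 0 - 1 := by rw [hgL U hU1.ge]; simp [halfMapInv, hU1]
  have hgZ : g Z = R (r - 1) := by
    rw [hZ, hR _ (Nat.sub_le _ _), show r = r - 1 + 1 by omega, Function.iterate_succ_apply', hgf]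
    simp
  have hr2 : 2 ≤ r := by
    by_contra hlt
    obtain rfl : r = 1 := by omega
    rw [hZR, hRs 0, halfMap_zero_coord, show R 0 = X from rfl, hX0, hX1] at hZ0
    linarith
  have hA0 : 0 < R (r - 1) 0 := by
    rw [hR _ (by omega)]; exact hfpos _ (by omega) (by omega)
  have hY0 : Y 0 = 0 := hY.2
  -- Reducing the index makes `Q (N + 1 + r)` equal to `U`, so the closing edge has the same form as
  -- the others.
  set Q : ℕ → Plane := fun j => omegaVertex f g X U (N + 1) (j % (N + 1 + r)) with hQdef
  have hpoly : OrbitPolygon τL δL τR δR S R Q U Y N r := by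
    refine
    { δL_pos := hδL
      δR_pos := hδR
      S_succ := hSs
      R_succ := hRs
      S_last := hSN
      R_zero0 := hX0
      R_zero1 := by rw [show R 0 = X from rfl, hX1]; exact hβ
      N_pos := hN
      r_pos := hr1
      S_neg := hSneg
      S_zero1 := hV1
      R_pos := fun i h0 hi => by rw [hR i hi.le]; exact hfpos i h0 hi
      R_last := by rw [← hZR]; exact hZ0
      U1 := hU1
      U_mem := ?_
      Q_zero := ?_
      Q_eq_S := ?_
      Q_eq_R := ?_
      Q_last := ?_
      Y_mem := ?_
      Y0 := hY0
      U_lt_Y := by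
        have := hYass.2
        rw [hgU1] at this
        linarith
      orient_left := by
        rw [← hZR, ← hfV]
        exact orient_neg_of_liesRightOfLine (a := V) (by rw [hfV]; linarith) hZass2
      orient_image := ?_ }
    -- The heights `V 1 ≤ 0 < S 1 1` put `U` on the segment from `V` to `f V`, not merely on the
    -- line.
    · have h1 := hU.1
      rw [hfV] at h1
      obtain ⟨c, hc⟩ := exists_coord_eq_of_mem_line h1
      have h2 := hc 1
      rw [hU1] at h2
      refine ⟨c, ?_, ?_, eq_smul_add_smul_of_coord hc⟩
      · by_contra hneg
        have := mul_neg_of_neg_of_pos (not_le.mp hneg) (show 0 < S 1 1 - V 1 by linarith)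
        linarith
      · by_contra hge
        have := mul_le_mul_of_nonneg_right (not_lt.mp hge) (show 0 ≤ S 1 1 - V 1 by linarith)
        linarith
    · simp [hQdef, omegaVertex]
    · intro j h0 hj
      simp only [hQdef, omegaVertex]
      rw [Nat.mod_eq_of_lt (by omega), if_neg (by omega), Nat.add_sub_cancel]
      split_ifs with hjN
      · exact (hS j hjN).symm
      · obtain rfl : j = N + 1 := by omega
        rw [Nat.add_sub_cancel_left, hSs, hSN, ← hfL X hX0.le]
        rfl
    · intro j hj
      simp only [hQdef, omegaVertex]
      rw [Nat.mod_eq_of_lt (by omega), if_neg (by omega), Nat.add_sub_cancel, hR j hj]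
      split_ifs with hjN
      · obtain rfl : j = 0 := by omega
        simp
      · rw [Nat.add_sub_cancel_left]
    · simp [hQdef, omegaVertex]
    · have h1 := hY.1
      rw [hgZ] at h1
      obtain ⟨c, hc⟩ := exists_coord_eq_of_mem_line h1
      have h2 := hc 0
      rw [hY0] at h2
      refine ⟨c, 1 - c, ?_, ?_, by ring, ?_⟩
      · by_contra hneg
        have := mul_neg_of_neg_of_pos (not_le.mp hneg) (show 0 < R (r - 1) 0 - Z 0 by linarith)
        linarith
      · by_contra hneg
        have := mul_lt_mul_of_pos_right (show 1 < c by linarith)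
          (show 0 < R (r - 1) 0 - Z 0 by linarith)
        linarith
      · rw [← hZR, add_comm]
        exact (eq_smul_add_smul_of_coord hc).symm
    -- This inequality is the image under the left half-map of the position of `Z` above the line
    -- through `g U` and `V`.
    · have h1 : U = halfMap τL δL (g U) := by rw [← hfL _ hgU0.le, hfg]
      rw [h1, hSs 0, orient_halfMap, ← hZR]
      exact mul_neg_of_pos_of_neg hδL
        (orient_neg_of_liesAboveLine (by rw [hgU0]; exact hV0) hZass1)
  have hΩ : omegaPolygon f g X U (N + 1) r = starHull Q (N + 1 + r) :=
    hpoly.isStar.filledPolygon_eq fun _ => rfl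
  have hfe : f = bcnfHomeomorph τL τR hδL hδR := hf
  rw [hΩ]
  rw [hfe] at hfL hfR ⊢
  have hinv := hpoly.forward_invariant hfL hfR
  refine ⟨hinv, fun ε hε => exists_trappingRegion _ (isCompact_starHull Q _) hinv ?_
    (hpoly.iterate_mem_interior hfL hfR) hε⟩
  exact (starHull_subset_closure Q _).trans
    (closure_mono hpoly.isStar.starInterior_subset_interior)
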